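/- Consider a discrete-time linear time-invariant system with $m$ inputs and one output, with proper $1\times m$ transfer function matrix $\mathsf G(z)=\frac{1}{\mathsf D(z)}\mathsf N(z)$ of minimal order $n$, where $\mathsf D$ is a monic real polynomial of degree $n$ and $\mathsf N$ is a row of real polynomials of degree at most $n$. Its trajectories are the input-output trajectories (from arbitrary initial states) of a minimal state-space realization, and its lag $l$ is the observability index of that realization. Let $N\ge l$, and let $U_{\mathrm p}\in\mathbb R^{mN\times T}$, $U_{\mathrm f}\in\mathbb R^{m\times T}$, $Y_{\mathrm p}\in\mathbb R^{N\times T}$, $Y_{\mathrm f}\in\mathbb R^{1\times T}$ be such that each column of $\begin{bmatrix}U_{\mathrm p}\\U_{\mathrm f}\end{bmatrix}$, $\begin{bmatrix}Y_{\mathrm p}\\Y_{\mathrm f}\end{bmatrix}$ is the input part, respectively the output part, of a trajectory of length $N+1$ (the same trajectory for the same column index). Put $\mathrm H=\begin{bmatrix}U_{\mathrm p}\\U_{\mathrm f}\\Y_{\mathrm p}\end{bmatrix}$ and assume $\operatorname{rank}\mathrm H=m(N+1)+n$. For a row $h=[b_0^\top,\dots,b_N^\top,a_0,\dots,a_{N-1}]$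 with $b_k\in\mathbb R^m$ and $a_k\in\mathbb R$, let $P_h(z)=z^N-\sum_{k=0}^{N-1}a_kz^k$ and $Q_h(z)=\sum_{k=0}^{N}b_k^\top z^k$; the roots of $P_h$ are the poles of the predictor $y(t)=h\,\mathrm{col}(u(t-N),\dots,u(t),y(t-N),\dots,y(t-1))$. Let $\mathrm H^\dagger$ be the Moore–Penrose inverse of $\mathrm H$, and let $\sigma_{\min}(\mathrm H)$ be its smallest nonzero singular value. For $\tau>0$ and a matrix $A$ with singular value decomposition $A=U\Sigma V^\top$, let $[A_\tau]^\dagger=V\Sigma_\tau^{+}U^\top$, where $\Sigma_\tau^{+}$ is obtained from $\Sigma^\top$ by inverting the singular values greater than $\tau$ and replacing the others by $0$. Assume $0<\tau<\sigma_{\min}(\mathrm H)$. Then there is a monic real polynomial $\mathsf C^\star$ of degree $N-n$, all of whose complex roots have modulus less than $1$, such that for $h^\star=Y_{\mathrm f}\mathrm H^\dagger$ one has $P_{h^\star}=\mathsf C^\star\mathsf D$ and $Q_{h^\star}=\mathsf C^\star\mathsf N$. Moreover, let $p_1,\dots,p_n$ be the complex roots of $\mathsf D$ (the system poles) and $q_1,\dots,q_{N-n}$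 those of $\mathsf C^\star$ (the latent poles), listed with multiplicity. For every $\epsilon>0$ there is $\delta>0$ such that for all noise matrices $E\in\mathbb R^{(m(N+1)+N)\times T}$ and $e\in\mathbb R^{1\times T}$ with $\lVert[E^\top,e^\top]\rVert_2<\delta$ (spectral norm), with $\tilde h=(Y_{\mathrm f}+e)\,[(\mathrm H+E)_\tau]^\dagger$, there are complex numbers $\tilde p_1,\dots,\tilde p_n,\tilde q_1,\dots,\tilde q_{N-n}$ with $$P_{\tilde h}(z)=\prod_{k=1}^{n}(z-\tilde p_k)\prod_{j=1}^{N-n}(z-\tilde q_j),$$ $|\tilde p_k-p_k|<\epsilon$ for every $k$, and $|\tilde q_j-q_j|<\epsilon$ and $|\tilde q_j|<1$ for every $j$. -/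

import Mathlib

open scoped Polynomial Matrix Matrix.Norms.L2Operator

noncomputable section

namespace DataDriven

/-! ### Discrete-time linear time-invariant systems with `m` inputs and one output -/

/-- A state-space representation `x(t+1) = A x(t) + B u(t)`, `y(t) = C x(t) + D u(t)` with `s`
states, `m` inputs and a scalar output. -/
structure StateSpace (m s : ℕ) where
  /-- the state matrix -/
  A : Matrix (Fin s) (Fin s) ℝ
  /-- the input matrix -/
  B : Matrix (Fin s) (Fin m) ℝ
  /-- the output row vector -/
  C : Fin s → ℝ
  /-- the feedthrough row vector -/
  D : Fin m → ℝ

namespace StateSpace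

variable {m s : ℕ}

/-- The `1 × m` transfer function matrix `C (zI - A)⁻¹ B + D`. -/
def transfer (S : StateSpace m s) : Fin m → RatFunc ℝ :=
  (fun i => (RatFunc.C (S.C i) : RatFunc ℝ)) ᵥ*
      (((RatFunc.X : RatFunc ℝ) • (1 : Matrix (Fin s) (Fin s) (RatFunc ℝ)) -
          S.A.map (RatFunc.C : ℝ →+* RatFunc ℝ))⁻¹ *
        S.B.map (RatFunc.C : ℝ →+* RatFunc ℝ))
    + fun j => (RatFunc.C (S.D j) : RatFunc ℝ)

/-- `S` is a minimal realization of the transfer function matrix `G`: it realizes `G`, and no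
realization of `G` has fewer states. The number `s` of its states is the minimal order of `G`. -/
def IsMinimalRealization (S : StateSpace m s) (G : Fin m → RatFunc ℝ) : Prop :=
  S.transfer = G ∧ ∀ (s' : ℕ) (S' : StateSpace m s'), S'.transfer = G → s ≤ s'

/-- The observability matrix `[C; C A; …; C A ^ (k-1)]`. -/
def obsMatrix (S : StateSpace m s) (k : ℕ) : Matrix (Fin k) (Fin s) ℝ :=
  Matrix.of fun i => S.C ᵥ* S.A ^ (i : ℕ)

/-- `l` is the observability index of `S`: the least number of block rows for which the
observability matrix has full column rank. For a minimal realization this is the lag of the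
system. -/
def IsLag (S : StateSpace m s) (l : ℕ) : Prop :=
  IsLeast {k : ℕ | (S.obsMatrix k).rank = s} l

/-- `(u, y)` is an input-output trajectory of length `k` of the system `S` (from some initial
state). -/
def IsTrajectory (S : StateSpace m s) {k : ℕ} (u : Fin k → Fin m → ℝ) (y : Fin k → ℝ) : Prop :=
  ∃ x : Fin (k + 1) → Fin s → ℝ,
    (∀ t : Fin k, x t.succ = S.A *ᵥ x t.castSucc + S.B *ᵥ u t) ∧
    ∀ t : Fin k, y t = S.C ⬝ᵥ x t.castSucc + S.D ⬝ᵥ u t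

end StateSpace

/-- `G = (1 / D) N` with `D` monic of degree `n` and the entries of the row `N` of degree at most
`n`. -/
def IsFraction {m : ℕ} (G : Fin m → RatFunc ℝ) (n : ℕ) (D : ℝ[X]) (Nm : Fin m → ℝ[X]) : Prop :=
  D.Monic ∧ D.natDegree = n ∧ (∀ j, (Nm j).natDegree ≤ n) ∧
    ∀ j, G j = algebraMap ℝ[X] (RatFunc ℝ) (Nm j) / algebraMap ℝ[X] (RatFunc ℝ) D

/-- All complex roots lie in the open unit disc. -/
def IsSchur (p : ℝ[X]) : Prop := ∀ z : ℂ, Polynomial.aeval z p = 0 → ‖z‖ < 1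

/-! ### Singular values and (truncated) Moore–Penrose inverses -/

section Matrices

set_option linter.unusedSectionVars false

variable {ι κ : Type*} [Fintype ι] [Fintype κ] [DecidableEq ι] [DecidableEq κ]

/-- The smallest nonzero singular value. -/
def sigmaMin (M : Matrix ι κ ℝ) : ℝ :=
  sInf {s : ℝ | s ≠ 0 ∧ ∃ i : ℕ, s = (Matrix.toEuclideanLin M).singularValues i}

/-- `M = U diag(σ) Vᵀ` is a singular value decomposition in reduced form: the columns of `U` and
those of `V` are orthonormal and `σ ≥ 0`. The singular values may be listed in any order, and
zero singular values may be left out. -/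
def IsSVD (M : Matrix ι κ ℝ) {r : ℕ} (U : Matrix ι (Fin r) ℝ) (σ : Fin r → ℝ)
    (V : Matrix κ (Fin r) ℝ) : Prop :=
  Uᵀ * U = 1 ∧ Vᵀ * V = 1 ∧ (∀ k, 0 ≤ σ k) ∧ M = U * Matrix.diagonal σ * Vᵀ

theorem exists_isSVD (M : Matrix ι κ ℝ) :
    ∃ (r : ℕ) (U : Matrix ι (Fin r) ℝ) (σ : Fin r → ℝ) (V : Matrix κ (Fin r) ℝ),
      IsSVD M U σ V ∧ ∀ k, 0 < σ k := by
  have hH : (Mᵀ * M).IsHermitian := by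
    rw [← Matrix.conjTranspose_eq_transpose_of_trivial]
    exact Matrix.isHermitian_conjTranspose_mul_self M
  have hpsd : (Mᵀ * M).PosSemidef := by
    rw [← Matrix.conjTranspose_eq_transpose_of_trivial]
    exact Matrix.posSemidef_conjTranspose_mul_self M
  have hnn : ∀ i, 0 ≤ hH.eigenvalues i := fun i => hpsd.eigenvalues_nonneg i
  obtain ⟨W, hWdef⟩ : ∃ W : Matrix κ κ ℝ, W = (hH.eigenvectorUnitary : Matrix κ κ ℝ) := ⟨_, rfl⟩
  have hW1 : Wᵀ * W = 1 := by
    have := Unitary.coe_star_mul_self hH.eigenvectorUnitary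
    rwa [← hWdef, Matrix.star_eq_conjTranspose,
      Matrix.conjTranspose_eq_transpose_of_trivial] at this
  have hW2 : W * Wᵀ = 1 := mul_eq_one_comm.mp hW1
  have hcol : ∀ j, (Mᵀ * M) *ᵥ (W.col j) = hH.eigenvalues j • W.col j := by
    intro j
    have h1 : W.col j = (hH.eigenvectorBasis j).ofLp := by
      ext i
      rw [hWdef, Matrix.col_apply, hH.eigenvectorUnitary_apply]
    rw [h1]
    exact hH.mulVec_eigenvectorBasis j
  have hMW : Mᵀ * M * W = W * Matrix.diagonal hH.eigenvalues := by
    ext i j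
    have := congrFun (hcol j) i
    rw [Matrix.mul_diagonal]
    simpa [Matrix.mul_apply, Matrix.mulVec, dotProduct, mul_comm] using this
  have hzero : ∀ j, hH.eigenvalues j = 0 → ∀ a, (M * W) a j = 0 := by
    intro j hj a
    have h1 : ((M * W)ᵀ * (M * W)) j j = 0 := by
      have : (M * W)ᵀ * (M * W) = Matrix.diagonal hH.eigenvalues := by
        rw [Matrix.transpose_mul, Matrix.mul_assoc, ← Matrix.mul_assoc Mᵀ, hMW,
          ← Matrix.mul_assoc, hW1, Matrix.one_mul]
      rw [this, Matrix.diagonal_apply_eq, hj]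
    rw [Matrix.mul_apply] at h1
    have h2 := (Finset.sum_eq_zero_iff_of_nonneg
      (fun i _ => by simpa using mul_self_nonneg ((M * W) i j))).mp h1 a (Finset.mem_univ a)
    simpa using h2
  let S := {i : κ // hH.eigenvalues i ≠ 0}
  let e : Fin (Fintype.card S) ≃ S := (Fintype.equivFin S).symm
  obtain ⟨V, hV⟩ : ∃ V : Matrix κ (Fin (Fintype.card S)) ℝ,
    V = W.submatrix id (fun k => (e k).1) := ⟨_, rfl⟩
  obtain ⟨σ, hσ⟩ : ∃ σ : Fin (Fintype.card S) → ℝ,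
    σ = fun k => Real.sqrt (hH.eigenvalues (e k).1) := ⟨_, rfl⟩
  have hσpos : ∀ k, 0 < σ k := fun k => by
    rw [hσ]
    exact Real.sqrt_pos.mpr (lt_of_le_of_ne (hnn _) (Ne.symm (e k).2))
  have hσsq : ∀ k, hH.eigenvalues (e k).1 = σ k * σ k := fun k => by
    rw [hσ]
    exact (Real.mul_self_sqrt (hnn _)).symm
  have hVV : Vᵀ * V = 1 := by
    have h1 : Vᵀ * V = (Wᵀ * W).submatrix (fun k => (e k).1) (fun k => (e k).1) := by
      rw [hV]
      ext i j
      simp [Matrix.mul_apply]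
    rw [h1, hW1]
    exact Matrix.submatrix_one _ (Subtype.val_injective.comp e.injective)
  have hMV : Mᵀ * M * V = V * Matrix.diagonal (fun k => σ k * σ k) := by
    ext i k
    have := congrFun (congrFun hMW i) (e k).1
    rw [Matrix.mul_diagonal] at this ⊢
    rw [← hσsq, hV]
    simpa [Matrix.mul_apply] using this
  have hVVt : M * V * Vᵀ = M := by
    ext a b
    calc (M * V * Vᵀ) a b = ∑ k, (M * W) a (e k).1 * W b (e k).1 := by
          rw [hV]
          simp [Matrix.mul_apply]
      _ = ∑ s : S, (M * W) a s.1 * W b s.1 :=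
          Equiv.sum_comp e (fun s : S => (M * W) a s.1 * W b s.1)
      _ = ∑ i, (M * W) a i * W b i := by
          rw [← Finset.sum_subtype (Finset.univ.filter fun i => hH.eigenvalues i ≠ 0)
            (by simp) (fun i => (M * W) a i * W b i), Finset.sum_filter]
          refine Finset.sum_congr rfl fun i _ => ?_
          by_cases hi : hH.eigenvalues i = 0
          · simp [hi, hzero i hi a]
          · simp [hi]
      _ = (M * W * Wᵀ) a b := by
          rw [Matrix.mul_apply]
          rfl
      _ = M a b := by rw [Matrix.mul_assoc, hW2, Matrix.mul_one]
  refine ⟨_, M * V * Matrix.diagonal (fun k => (σ k)⁻¹), σ, V,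
    ⟨?_, hVV, fun k => (hσpos k).le, ?_⟩, hσpos⟩
  · rw [Matrix.transpose_mul, Matrix.transpose_mul, Matrix.diagonal_transpose]
    calc Matrix.diagonal (fun k => (σ k)⁻¹) * (Vᵀ * Mᵀ) *
          (M * V * Matrix.diagonal (fun k => (σ k)⁻¹))
        = Matrix.diagonal (fun k => (σ k)⁻¹) * (Vᵀ * (Mᵀ * M * V)) *
          Matrix.diagonal (fun k => (σ k)⁻¹) := by simp only [Matrix.mul_assoc]
      _ = 1 := by
          rw [hMV, ← Matrix.mul_assoc Vᵀ, hVV, Matrix.one_mul, Matrix.diagonal_mul_diagonal,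
            Matrix.diagonal_mul_diagonal, ← Matrix.diagonal_one]
          congr 1
          funext k
          have := (hσpos k).ne'
          field_simp
  · rw [Matrix.mul_assoc _ (Matrix.diagonal _) (Matrix.diagonal _),
      Matrix.diagonal_mul_diagonal]
    have : (fun k => (σ k)⁻¹ * σ k) = fun _ => (1 : ℝ) := by
      funext k
      exact inv_mul_cancel₀ (hσpos k).ne'
    rw [this, Matrix.diagonal_one, Matrix.mul_one, hVVt]

/-- `X` is the Moore–Penrose inverse of `M`. -/
def IsMoorePenrose (M : Matrix ι κ ℝ) (X : Matrix κ ι ℝ) : Prop :=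
  M * X * M = M ∧ X * M * X = X ∧ (M * X)ᵀ = M * X ∧ (X * M)ᵀ = X * M

theorem exists_isMoorePenrose (M : Matrix ι κ ℝ) : ∃ X, IsMoorePenrose M X := by
  obtain ⟨r, U, σ, V, ⟨hU, hV, -, hM⟩, hσ⟩ := exists_isSVD M
  have h1 : Matrix.diagonal σ * Matrix.diagonal (fun k => (σ k)⁻¹) = 1 := by
    rw [Matrix.diagonal_mul_diagonal, ← Matrix.diagonal_one]
    congr 1
    funext k
    exact mul_inv_cancel₀ (hσ k).ne'
  have h2 : Matrix.diagonal (fun k => (σ k)⁻¹) * Matrix.diagonal σ = 1 := mul_eq_one_comm.mp h1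
  have hMX : M * (V * Matrix.diagonal (fun k => (σ k)⁻¹) * Uᵀ) = U * Uᵀ := by
    calc M * (V * Matrix.diagonal (fun k => (σ k)⁻¹) * Uᵀ)
        = U * (Matrix.diagonal σ * (Vᵀ * V) * Matrix.diagonal (fun k => (σ k)⁻¹)) * Uᵀ := by
          rw [hM]
          simp only [Matrix.mul_assoc]
      _ = U * Uᵀ := by rw [hV, Matrix.mul_one, h1, Matrix.mul_one]
  have hXM : V * Matrix.diagonal (fun k => (σ k)⁻¹) * Uᵀ * M = V * Vᵀ := by
    calc V * Matrix.diagonal (fun k => (σ k)⁻¹) * Uᵀ * M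
        = V * (Matrix.diagonal (fun k => (σ k)⁻¹) * (Uᵀ * U) * Matrix.diagonal σ) * Vᵀ := by
          rw [hM]
          simp only [Matrix.mul_assoc]
      _ = V * Vᵀ := by rw [hU, Matrix.mul_one, h2, Matrix.mul_one]
  refine ⟨V * Matrix.diagonal (fun k => (σ k)⁻¹) * Uᵀ, ?_, ?_, ?_, ?_⟩
  · rw [hMX, hM, Matrix.mul_assoc U Uᵀ, Matrix.mul_assoc U (Matrix.diagonal σ),
      ← Matrix.mul_assoc Uᵀ, hU, Matrix.one_mul]
  · rw [hXM, Matrix.mul_assoc V Vᵀ, Matrix.mul_assoc V (Matrix.diagonal _),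
      ← Matrix.mul_assoc Vᵀ, hV, Matrix.one_mul]
  · rw [hMX, Matrix.transpose_mul, Matrix.transpose_transpose]
  · rw [hXM, Matrix.transpose_mul, Matrix.transpose_transpose]

theorem IsMoorePenrose.unique {M : Matrix ι κ ℝ} {X Y : Matrix κ ι ℝ}
    (hX : IsMoorePenrose M X) (hY : IsMoorePenrose M Y) : X = Y := by
  obtain ⟨hX1, hX2, hX3, hX4⟩ := hX
  obtain ⟨hY1, hY2, hY3, hY4⟩ := hY
  have h1 : X * M = Y * M := by
    calc X * M = (X * M)ᵀ := hX4.symm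
      _ = (X * (M * Y * M))ᵀ := by rw [hY1]
      _ = ((X * M) * (Y * M))ᵀ := by simp only [Matrix.mul_assoc]
      _ = (Y * M) * (X * M) := by rw [Matrix.transpose_mul, hX4, hY4]
      _ = Y * (M * X * M) := by simp only [Matrix.mul_assoc]
      _ = Y * M := by rw [hX1]
  have h2 : M * X = M * Y := by
    calc M * X = (M * X)ᵀ := hX3.symm
      _ = ((M * Y * M) * X)ᵀ := by rw [hY1]
      _ = ((M * Y) * (M * X))ᵀ := by simp only [Matrix.mul_assoc]
      _ = (M * X) * (M * Y) := by rw [Matrix.transpose_mul, hX3, hY3]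
      _ = (M * X * M) * Y := by simp only [Matrix.mul_assoc]
      _ = M * Y := by rw [hX1]
  calc X = X * M * X := hX2.symm
    _ = Y * (M * X) := by rw [h1, Matrix.mul_assoc]
    _ = Y * M * Y := by rw [h2, Matrix.mul_assoc]
    _ = Y := hY2

/-- The Moore–Penrose inverse. -/
def pinv (M : Matrix ι κ ℝ) : Matrix κ ι ℝ := (exists_isMoorePenrose M).choose

theorem pinv_spec (M : Matrix ι κ ℝ) : IsMoorePenrose M (pinv M) :=
  (exists_isMoorePenrose M).choose_spec

/-- `X` is the truncated Moore–Penrose inverse of `M` with tolerance `τ`: for a singular value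
decomposition `M = U diag(σ) Vᵀ`, it is `X = V diag(σ') Uᵀ`, where `σ'` inverts the singular values
greater than `τ` and replaces the others by `0`. -/
def IsTruncPinv (τ : ℝ) (M : Matrix ι κ ℝ) (X : Matrix κ ι ℝ) : Prop :=
  ∃ (r : ℕ) (U : Matrix ι (Fin r) ℝ) (σ : Fin r → ℝ) (V : Matrix κ (Fin r) ℝ),
    IsSVD M U σ V ∧
      X = V * Matrix.diagonal (fun k => if τ < σ k then (σ k)⁻¹ else 0) * Uᵀ

theorem exists_isTruncPinv (τ : ℝ) (M : Matrix ι κ ℝ) : ∃ X, IsTruncPinv τ M X := by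
  obtain ⟨r, U, σ, V, h, -⟩ := exists_isSVD M
  exact ⟨_, r, U, σ, V, h, rfl⟩

/-- The truncated Moore–Penrose inverse does not depend on the singular value decomposition. -/
theorem IsTruncPinv.unique {τ : ℝ} {M : Matrix ι κ ℝ} {X Y : Matrix κ ι ℝ}
    (hX : IsTruncPinv τ M X) (hY : IsTruncPinv τ M Y) : X = Y := by
  obtain ⟨r, U, σ, V, ⟨hU, hV, hσ, hM⟩, rfl⟩ := hX
  obtain ⟨r', U', σ', V', ⟨hU', hV', hσ', hM'⟩, rfl⟩ := hY
  have hMt : Mᵀ = V * Matrix.diagonal σ * Uᵀ := by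
    rw [hM]
    simp only [Matrix.transpose_mul, Matrix.transpose_transpose, Matrix.diagonal_transpose,
      Matrix.mul_assoc]
  have hMt' : Mᵀ = V' * Matrix.diagonal σ' * U'ᵀ := by
    rw [hM']
    simp only [Matrix.transpose_mul, Matrix.transpose_transpose, Matrix.diagonal_transpose,
      Matrix.mul_assoc]
  have a1 : Uᵀ * M = Matrix.diagonal σ * Vᵀ := by
    rw [hM, Matrix.mul_assoc U, ← Matrix.mul_assoc, hU, Matrix.one_mul]
  have a2 : Vᵀ * Mᵀ = Matrix.diagonal σ * Uᵀ := by
    rw [hMt, Matrix.mul_assoc V, ← Matrix.mul_assoc, hV, Matrix.one_mul]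
  have b1 : M * V' = U' * Matrix.diagonal σ' := by
    rw [hM', Matrix.mul_assoc, hV', Matrix.mul_one]
  have b2 : Mᵀ * U' = V' * Matrix.diagonal σ' := by
    rw [hMt', Matrix.mul_assoc, hU', Matrix.mul_one]
  have c1 : Matrix.diagonal σ * (Vᵀ * V') = Uᵀ * U' * Matrix.diagonal σ' := by
    rw [← Matrix.mul_assoc, ← a1, Matrix.mul_assoc, b1, ← Matrix.mul_assoc]
  have c2 : Matrix.diagonal σ * (Uᵀ * U') = Vᵀ * V' * Matrix.diagonal σ' := by
    rw [← Matrix.mul_assoc, ← a2, Matrix.mul_assoc, b2, ← Matrix.mul_assoc]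
  obtain ⟨g, hg⟩ : ∃ g : ℝ → ℝ, g = fun s => if τ < s then s⁻¹ else 0 := ⟨_, rfl⟩
  have hg0 : g 0 = 0 := by simp [hg]
  have key : Matrix.diagonal (fun k => g (σ k)) * (Uᵀ * U') =
      Vᵀ * V' * Matrix.diagonal (fun k => g (σ' k)) := by
    ext k l
    have e1 := congrFun (congrFun c1 k) l
    have e2 := congrFun (congrFun c2 k) l
    rw [Matrix.diagonal_mul, Matrix.mul_diagonal] at e1 e2 ⊢
    generalize (Uᵀ * U') k l = K at *
    generalize (Vᵀ * V') k l = L at *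
    have hk := hσ k
    have hl := hσ' l
    by_cases hs : σ k = σ' l
    · rcases hk.eq_or_lt with h0 | h0
      · rw [← hs, ← h0, hg0, zero_mul, mul_zero]
      · have : L = K := by
          rw [← hs, mul_comm] at e1
          exact mul_right_cancel₀ h0.ne' e1
        rw [this, hs, mul_comm]
    · have hsum : σ k + σ' l ≠ 0 := by
        intro h
        apply hs
        linarith
      have h1 : K + L = 0 ∨ K - L = 0 := by
        left
        have : (σ k - σ' l) * (K + L) = 0 := by linear_combination e1 + e2
        exact (mul_eq_zero.mp this).resolve_left (sub_ne_zero.mpr hs)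
      have h2 : K - L = 0 := by
        have : (σ k + σ' l) * (K - L) = 0 := by linear_combination e2 - e1
        exact (mul_eq_zero.mp this).resolve_left hsum
      have h3 : K + L = 0 := by
        have : (σ k - σ' l) * (K + L) = 0 := by linear_combination e1 + e2
        exact (mul_eq_zero.mp this).resolve_left (sub_ne_zero.mpr hs)
      have hK : K = 0 := by linarith
      have hL : L = 0 := by linarith
      rw [hK, hL, mul_zero, zero_mul]
  have hfac : ∀ {q : ℕ} (s : Fin q → ℝ), (Matrix.diagonal fun k => g (s k)) =
      Matrix.diagonal s * Matrix.diagonal fun k => g (s k) * (s k)⁻¹ := by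
    intro q s
    rw [Matrix.diagonal_mul_diagonal]
    congr 1
    funext k
    by_cases h : s k = 0
    · rw [h, hg0]
      simp
    · field_simp
  have d1 : V * Vᵀ * (V' * Matrix.diagonal fun k => g (σ' k)) =
      V' * Matrix.diagonal fun k => g (σ' k) := by
    have : V * Vᵀ * (V' * Matrix.diagonal σ') = V' * Matrix.diagonal σ' := by
      rw [← b2, hMt, Matrix.mul_assoc V (Matrix.diagonal σ), Matrix.mul_assoc V Vᵀ,
        Matrix.mul_assoc V (_ * _), ← Matrix.mul_assoc Vᵀ, hV, Matrix.one_mul]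
    rw [hfac σ', ← Matrix.mul_assoc V', ← Matrix.mul_assoc (V * Vᵀ), this]
  have d2 : (U * Matrix.diagonal fun k => g (σ k)) = U' * U'ᵀ * (U * Matrix.diagonal fun k => g (σ k)) := by
    have hMV : M * V = U * Matrix.diagonal σ := by
      rw [hM, Matrix.mul_assoc, hV, Matrix.mul_one]
    have : U' * U'ᵀ * (U * Matrix.diagonal σ) = U * Matrix.diagonal σ := by
      rw [← hMV, hM', Matrix.mul_assoc U' (Matrix.diagonal σ'), Matrix.mul_assoc U' U'ᵀ,
        Matrix.mul_assoc U' (_ * _), ← Matrix.mul_assoc U'ᵀ, hU', Matrix.one_mul]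
    rw [hfac σ, ← Matrix.mul_assoc U, ← Matrix.mul_assoc (U' * U'ᵀ), this]
  have d3 : (Matrix.diagonal fun k => g (σ k)) * Uᵀ =
      (Matrix.diagonal fun k => g (σ k)) * Uᵀ * U' * U'ᵀ := by
    have := congrArg Matrix.transpose d2
    simpa only [Matrix.transpose_mul, Matrix.transpose_transpose, Matrix.diagonal_transpose,
      Matrix.mul_assoc] using this
  have e1 : (fun k => if τ < σ k then (σ k)⁻¹ else 0) = fun k => g (σ k) := by rw [hg]
  have e2 : (fun k => if τ < σ' k then (σ' k)⁻¹ else 0) = fun k => g (σ' k) := by rw [hg]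
  rw [e1, e2, Matrix.mul_assoc, d3]
  calc V * (Matrix.diagonal (fun k => g (σ k)) * Uᵀ * U' * U'ᵀ)
      = V * (Matrix.diagonal (fun k => g (σ k)) * (Uᵀ * U')) * U'ᵀ := by
        simp only [Matrix.mul_assoc]
    _ = V * Vᵀ * (V' * Matrix.diagonal fun k => g (σ' k)) * U'ᵀ := by
        rw [key]
        simp only [Matrix.mul_assoc]
    _ = V' * Matrix.diagonal (fun k => g (σ' k)) * U'ᵀ := by rw [d1]

/-- The truncated Moore–Penrose inverse of `M` with tolerance `τ`. -/
def truncPinv (τ : ℝ) (M : Matrix ι κ ℝ) : Matrix κ ι ℝ := (exists_isTruncPinv τ M).choose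

theorem truncPinv_spec (τ : ℝ) (M : Matrix ι κ ℝ) : IsTruncPinv τ M (truncPinv τ M) :=
  (exists_isTruncPinv τ M).choose_spec

end Matrices

/-! ### The data-driven representation -/

/-- Row indices of `H`: the past inputs `u(t-N), …, u(t-1)`, the current input `u(t)`, and the past
outputs `y(t-N), …, y(t-1)`. -/
abbrev RegIndex (m N : ℕ) : Type := (Fin N × Fin m ⊕ Fin m) ⊕ Fin N

variable {m N T : ℕ}

/-- The data matrix `H = [Up; Uf; Yp]`. -/
def dataMatrix (Up : Matrix (Fin N × Fin m) (Fin T) ℝ) (Uf : Matrix (Fin m) (Fin T) ℝ)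
    (Yp : Matrix (Fin N) (Fin T) ℝ) : Matrix (RegIndex m N) (Fin T) ℝ :=
  Matrix.fromRows (Matrix.fromRows Up Uf) Yp

/-- Every column of `[Up; Uf; Yp; Yf]` is an input-output trajectory of length `N + 1` of `S`. -/
def IsData {s : ℕ} (S : StateSpace m s) (Up : Matrix (Fin N × Fin m) (Fin T) ℝ)
    (Uf : Matrix (Fin m) (Fin T) ℝ) (Yp : Matrix (Fin N) (Fin T) ℝ)
    (Yf : Matrix (Fin 1) (Fin T) ℝ) : Prop :=
  ∀ c : Fin T, S.IsTrajectory
    (Fin.snoc (α := fun _ => Fin m → ℝ) (fun (k : Fin N) j => Up (k, j) c) (fun j => Uf j c))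
    (Fin.snoc (α := fun _ => ℝ) (fun k : Fin N => Yp k c) (Yf 0 c))

/-- For the predictor `y(t) = h [u(t-N:t-1); u(t); y(t-N:t-1)]` with coefficient row
`h = [b₀ᵀ, …, b_Nᵀ, a₀, …, a_{N-1}]`, the polynomial `z ^ N - ∑ aₖ z ^ k`, whose roots are the poles
of the predictor. -/
def polePoly (h : Matrix (Fin 1) (RegIndex m N) ℝ) : ℝ[X] :=
  Polynomial.X ^ N - ∑ k : Fin N, Polynomial.C (h 0 (Sum.inr k)) * Polynomial.X ^ (k : ℕ)

/-- The row `∑ bₖᵀ z ^ k` of numerator polynomials of the predictor with coefficient row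
`h = [b₀ᵀ, …, b_Nᵀ, a₀, …, a_{N-1}]`. -/
def numPoly (h : Matrix (Fin 1) (RegIndex m N) ℝ) (j : Fin m) : ℝ[X] :=
  ∑ k : Fin N, Polynomial.C (h 0 (Sum.inl (Sum.inl (k, j)))) * Polynomial.X ^ (k : ℕ) +
    Polynomial.C (h 0 (Sum.inl (Sum.inr j))) * Polynomial.X ^ N

end DataDriven

end

open DataDriven

/-! The argument has an algebraic half, which describes the noise-free predictor, and a topological
half, which handles the noise.

Algebra. Any common multiple (`R * D`, `R * N`) of the fraction yields a difference equation obeyed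
by every trajectory (`StateSpace.IsTrajectory.sum_eq`). Minimality enters here: a minimal
realization is controllable, so `C D(A) = 0` and initial states leave no trace. For `deg R < N - n`
such a multiple is a vector of the left kernel of `H`, and the rank hypothesis makes the dimensions
agree, so there are no others (`vecMul_eq_zero_iff_multipleRow`). For `R` monic of degree `N - n` it
is an exact predictor. Hence `h⋆`, which differs from one exact predictor by a kernel vector, comes
from a monic `P` of degree `N - n`; this `P` is the required `C⋆`.

Stability. The row `h⋆` is orthogonal to the left kernel of `H`. So `P` is orthogonal to all
polynomials of lower degree for the inner product that sums, over `M` among `D` and the `N_j`, the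
coefficient products of `F * M` and `F' * M`. Multiplication by `z` is an isometry as long as no
coefficient leaves the window. If `P = (z - ζ) R`, then `z R = P + ζ R` with `P ⊥ R`, and Pythagoras
gives `‖R‖² = ‖P‖² + |ζ|² ‖R‖²`, whence `|ζ| < 1` (`isSchur_of_orthogonal`).

Noise. Truncated inverses are bounded by `τ⁻¹` and satisfy closed relations. Any limit point as the
noise vanishes satisfies them too, and `τ < sigmaMin H` forces it to be the Moore–Penrose inverse
(`tendsto_truncPinv`). Roots of monic polynomials depend continuously on the coefficients
(`eventually_exists_roots_mem`), and lying in the open disc is an open condition. -/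

noncomputable section

namespace DataDriven

open Polynomial

/-! ### The resolvent and its expansion -/

section Resolvent

variable {s : ℕ}

/-- The pencil `zI - A` over the rational functions. -/
def pencil (A : Matrix (Fin s) (Fin s) ℝ) : Matrix (Fin s) (Fin s) (RatFunc ℝ) :=
  (RatFunc.X : RatFunc ℝ) • (1 : Matrix (Fin s) (Fin s) (RatFunc ℝ)) -
    A.map (RatFunc.C : ℝ →+* RatFunc ℝ)

theorem pencil_eq_charmatrix_map (A : Matrix (Fin s) (Fin s) ℝ) :
    pencil A = A.charmatrix.map (algebraMap ℝ[X] (RatFunc ℝ)) := by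
  ext i j
  by_cases h : i = j
  · subst h
    simp [pencil, Matrix.charmatrix_apply_eq, RatFunc.algebraMap_X, RatFunc.algebraMap_C]
  · simp [pencil, h, RatFunc.algebraMap_C]

theorem isUnit_det_pencil (A : Matrix (Fin s) (Fin s) ℝ) : IsUnit (pencil A).det := by
  have h : (pencil A).det = algebraMap ℝ[X] (RatFunc ℝ) A.charpoly := by
    rw [pencil_eq_charmatrix_map, Matrix.charpoly, RingHom.map_det, RingHom.mapMatrix_apply]
  rw [h, isUnit_iff_ne_zero]
  exact RatFunc.algebraMap_ne_zero A.charpoly_monic.ne_zero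

/-- The bilinear form `v (zI - A)⁻¹ w`. -/
def resolventForm (A : Matrix (Fin s) (Fin s) ℝ) (v w : Fin s → ℝ) : RatFunc ℝ :=
  (fun i => RatFunc.C (v i)) ⬝ᵥ ((pencil A)⁻¹ *ᵥ fun i => RatFunc.C (w i))

theorem resolventForm_add_left (A : Matrix (Fin s) (Fin s) ℝ) (v v' w : Fin s → ℝ) :
    resolventForm A (v + v') w = resolventForm A v w + resolventForm A v' w := by
  rw [resolventForm, resolventForm, resolventForm, ← add_dotProduct]
  congr 1
  ext i
  simp

theorem resolventForm_smul_left (A : Matrix (Fin s) (Fin s) ℝ) (a : ℝ) (v w : Fin s → ℝ) :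
    resolventForm A (a • v) w = RatFunc.C a * resolventForm A v w := by
  rw [resolventForm, resolventForm, ← smul_eq_mul, ← smul_dotProduct]
  congr 1
  ext i
  simp

theorem resolventForm_zero_left (A : Matrix (Fin s) (Fin s) ℝ) (w : Fin s → ℝ) :
    resolventForm A 0 w = 0 := by
  simpa using resolventForm_smul_left A 0 0 w

theorem C_dotProduct (v w : Fin s → ℝ) :
    (fun i => (RatFunc.C (v i) : RatFunc ℝ)) ⬝ᵥ (fun i => RatFunc.C (w i)) =
      RatFunc.C (v ⬝ᵥ w) := by
  simp [dotProduct]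

theorem C_vecMul {r : ℕ} (v : Fin s → ℝ) (A : Matrix (Fin s) (Fin r) ℝ) :
    (fun i => (RatFunc.C (v i) : RatFunc ℝ)) ᵥ* A.map (RatFunc.C : ℝ →+* RatFunc ℝ) =
      fun i => RatFunc.C ((v ᵥ* A) i) := by
  ext i
  simp [Matrix.vecMul, dotProduct]

theorem C_mulVec {r : ℕ} (A : Matrix (Fin r) (Fin s) ℝ) (v : Fin s → ℝ) :
    A.map (RatFunc.C : ℝ →+* RatFunc ℝ) *ᵥ (fun i => (RatFunc.C (v i) : RatFunc ℝ)) =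
      fun i => RatFunc.C ((A *ᵥ v) i) := by
  ext i
  simp [Matrix.mulVec, dotProduct]

/-- This is `z (zI - A)⁻¹ = I + A (zI - A)⁻¹` between two vectors; every expansion below iterates
it. -/
theorem X_mul_resolventForm (A : Matrix (Fin s) (Fin s) ℝ) (v w : Fin s → ℝ) :
    RatFunc.X * resolventForm A v w = RatFunc.C (v ⬝ᵥ w) + resolventForm A (v ᵥ* A) w := by
  have h : (RatFunc.X : RatFunc ℝ) • (pencil A)⁻¹ =
      1 + A.map (RatFunc.C : ℝ →+* RatFunc ℝ) * (pencil A)⁻¹ := by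
    have := Matrix.mul_nonsing_inv (pencil A) (isUnit_det_pencil A)
    nth_rewrite 1 [pencil] at this
    rw [Matrix.sub_mul, Matrix.smul_mul, Matrix.one_mul] at this
    rw [← this]
    abel
  rw [resolventForm, ← smul_eq_mul, ← dotProduct_smul, ← Matrix.smul_mulVec, h,
    Matrix.add_mulVec, Matrix.one_mulVec, dotProduct_add, C_dotProduct, ← Matrix.mulVec_mulVec,
    Matrix.dotProduct_mulVec, C_vecMul, resolventForm]

/-- The polynomial part of `z ^ k (d + v (zI - A)⁻¹ w)`. -/
def polyPart (A : Matrix (Fin s) (Fin s) ℝ) (v w : Fin s → ℝ) (d : ℝ) : ℕ → ℝ[X]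
  | 0 => C d
  | k + 1 => X * polyPart A v w d k + C ((v ᵥ* A ^ k) ⬝ᵥ w)

theorem degree_polyPart_zero_lt (A : Matrix (Fin s) (Fin s) ℝ) (v w : Fin s → ℝ) (k : ℕ) :
    (polyPart A v w 0 k).degree < k := by
  cases k with
  | zero => simp [polyPart]
  | succ k =>
    suffices h : ∀ k, (polyPart A v w 0 (k + 1)).natDegree ≤ k by
      refine lt_of_le_of_lt degree_le_natDegree ?_
      exact_mod_cast Nat.lt_succ_of_le (h k)
    intro k
    induction k with
    | zero => simp [polyPart]
    | succ k ih =>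
      rw [polyPart]
      refine natDegree_add_le_of_degree_le ?_ (by simp)
      exact natDegree_mul_le.trans (by rw [natDegree_X]; omega)

theorem X_pow_mul_resolventForm (A : Matrix (Fin s) (Fin s) ℝ) (v w : Fin s → ℝ) (d : ℝ) (k : ℕ) :
    RatFunc.X ^ k * (resolventForm A v w + RatFunc.C d) =
      algebraMap ℝ[X] (RatFunc ℝ) (polyPart A v w d k) + resolventForm A (v ᵥ* A ^ k) w := by
  induction k with
  | zero => simp [polyPart, RatFunc.algebraMap_C, add_comm]
  | succ k ih =>
    rw [pow_succ', mul_assoc, ih, mul_add, X_mul_resolventForm, polyPart, Matrix.vecMul_vecMul,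
      pow_succ, map_add, map_mul, RatFunc.algebraMap_X, RatFunc.algebraMap_C, add_assoc]

/-- The polynomial part of `p(z) (d + v (zI - A)⁻¹ w)`. -/
def polyPartMul (A : Matrix (Fin s) (Fin s) ℝ) (v w : Fin s → ℝ) (d : ℝ) (p : ℝ[X]) : ℝ[X] :=
  p.sum fun k a => C a * polyPart A v w d k

theorem aeval_vecMul (A : Matrix (Fin s) (Fin s) ℝ) (v : Fin s → ℝ) (p : ℝ[X]) :
    v ᵥ* aeval A p = p.sum fun k a => a • (v ᵥ* A ^ k) := by
  rw [aeval_eq_sum_range, Matrix.vecMul_sum, sum_over_range _ (by simp)]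
  simp [Matrix.vecMul_smul]

/-- A division with remainder: multiplying by `p` leaves a polynomial plus a form of the same
strictly proper kind, with `v` replaced by `v p(A)`. -/
theorem mul_resolventForm (A : Matrix (Fin s) (Fin s) ℝ) (v w : Fin s → ℝ) (d : ℝ) (p : ℝ[X]) :
    algebraMap ℝ[X] (RatFunc ℝ) p * (resolventForm A v w + RatFunc.C d) =
      algebraMap ℝ[X] (RatFunc ℝ) (polyPartMul A v w d p) +
        resolventForm A (v ᵥ* aeval A p) w := by
  have h : ∀ (t : Finset ℕ) (f : ℕ → Fin s → ℝ), resolventForm A (∑ k ∈ t, f k) w =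
      ∑ k ∈ t, resolventForm A (f k) w := by
    intro t f
    induction t using Finset.cons_induction with
    | empty => simp [resolventForm_zero_left]
    | cons a t ha ih => rw [Finset.sum_cons, Finset.sum_cons, resolventForm_add_left, ih]
  rw [aeval_vecMul, polyPartMul, Polynomial.sum, Polynomial.sum, h, map_sum,
    ← Finset.sum_add_distrib]
  nth_rewrite 1 [p.as_sum_support]
  rw [map_sum, Finset.sum_mul]
  refine Finset.sum_congr rfl fun k _ => ?_
  rw [← C_mul_X_pow_eq_monomial, map_mul, map_pow, RatFunc.algebraMap_X, RatFunc.algebraMap_C,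
    mul_assoc, X_pow_mul_resolventForm, resolventForm_smul_left, map_mul, RatFunc.algebraMap_C,
    mul_add]

/-- The form is strictly proper. Multiplied by the characteristic polynomial it has no remainder, by
Cayley–Hamilton, and what is left has degree below that of the characteristic polynomial; a nonzero
`p` would make it at least as large. -/
theorem eq_zero_of_resolventForm_eq_algebraMap {A : Matrix (Fin s) (Fin s) ℝ} {v w : Fin s → ℝ}
    {p : ℝ[X]} (h : resolventForm A v w = algebraMap ℝ[X] (RatFunc ℝ) p) : p = 0 := by
  have h1 := mul_resolventForm A v w 0 A.charpoly
  rw [Matrix.aeval_self_charpoly, Matrix.vecMul_zero, resolventForm_zero_left, map_zero, add_zero,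
    add_zero, h, ← map_mul] at h1
  have h2 := RatFunc.algebraMap_injective ℝ h1
  by_contra hp
  have h3 : (polyPartMul A v w 0 A.charpoly).degree < A.charpoly.degree := by
    rw [polyPartMul, Polynomial.sum]
    refine (degree_sum_le _ _).trans_lt ?_
    rw [Finset.sup_lt_iff (bot_lt_iff_ne_bot.mpr
      (degree_ne_bot.mpr A.charpoly_monic.ne_zero))]
    intro k hk
    rw [← smul_eq_C_mul]
    refine lt_of_le_of_lt (degree_smul_le _ _)
      ((degree_polyPart_zero_lt A v w k).trans_le ?_)
    exact le_degree_of_mem_supp k hk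
  rw [← h2, degree_mul] at h3
  have h4 := zero_le_degree_iff.mpr hp
  exact absurd h3 (not_lt.mpr (le_add_of_nonneg_right h4))

/-- A polynomial resolvent form vanishes, and each multiplication by `z` then peels off one more
Markov parameter. -/
theorem markov_eq_zero {A : Matrix (Fin s) (Fin s) ℝ} {w : Fin s → ℝ} (k : ℕ) :
    ∀ {v : Fin s → ℝ} {p : ℝ[X]}, resolventForm A v w = algebraMap ℝ[X] (RatFunc ℝ) p →
      (v ᵥ* A ^ k) ⬝ᵥ w = 0 := by
  have key : ∀ {v : Fin s → ℝ} {p : ℝ[X]}, resolventForm A v w = algebraMap ℝ[X] (RatFunc ℝ) p →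
      v ⬝ᵥ w = 0 ∧ resolventForm A (v ᵥ* A) w = algebraMap ℝ[X] (RatFunc ℝ) 0 := by
    intro v p h
    have hp := eq_zero_of_resolventForm_eq_algebraMap h
    have h1 := X_mul_resolventForm A v w
    rw [h, hp, map_zero, mul_zero] at h1
    have h2 : resolventForm A (v ᵥ* A) w = algebraMap ℝ[X] (RatFunc ℝ) (C (-(v ⬝ᵥ w))) := by
      rw [RatFunc.algebraMap_C, map_neg]
      linear_combination -h1
    have h3 := eq_zero_of_resolventForm_eq_algebraMap h2
    rw [C_eq_zero, neg_eq_zero] at h3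
    refine ⟨h3, ?_⟩
    rw [h2, h3, neg_zero, C_0]
  induction k with
  | zero => exact fun h => by simpa using (key h).1
  | succ k ih =>
    intro v p h
    rw [pow_succ', ← Matrix.vecMul_vecMul]
    exact ih (key h).2

end Resolvent

/-! ### Minimal realizations and the polynomials that annihilate their output row. -/

namespace StateSpace

variable {m s : ℕ}

theorem transfer_apply (S : StateSpace m s) (j : Fin m) :
    S.transfer j = resolventForm S.A S.C (S.B.col j) + RatFunc.C (S.D j) := by
  rw [transfer, Pi.add_apply, resolventForm, Matrix.dotProduct_mulVec, ← Matrix.vecMul_vecMul]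
  rfl

/-- An intertwiner of the state matrices also intertwines the resolvents; `P` need not be injective.
-/
theorem transfer_eq_of_intertwine {r : ℕ} (S : StateSpace m s) (S' : StateSpace m r)
    (P : Matrix (Fin s) (Fin r) ℝ) (hA : S.A * P = P * S'.A) (hB : S.B = P * S'.B)
    (hC : S'.C = S.C ᵥ* P) (hD : S'.D = S.D) : S'.transfer = S.transfer := by
  set φ : Matrix (Fin s) (Fin r) (RatFunc ℝ) := P.map (RatFunc.C : ℝ →+* RatFunc ℝ) with hφ
  have h1 : pencil S.A * φ = φ * pencil S'.A := by
    have := congrArg (fun M => M.map (RatFunc.C : ℝ →+* RatFunc ℝ)) hA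
    simp only [Matrix.map_mul] at this
    rw [pencil, pencil, Matrix.sub_mul, Matrix.mul_sub, Matrix.smul_mul, Matrix.mul_smul,
      Matrix.one_mul, Matrix.mul_one, hφ, this]
  have h2 : (pencil S.A)⁻¹ * φ = φ * (pencil S'.A)⁻¹ := by
    calc (pencil S.A)⁻¹ * φ
        = (pencil S.A)⁻¹ * (φ * pencil S'.A) * (pencil S'.A)⁻¹ := by
          rw [Matrix.mul_assoc, Matrix.mul_assoc φ,
            Matrix.mul_nonsing_inv _ (isUnit_det_pencil _), Matrix.mul_one]
      _ = φ * (pencil S'.A)⁻¹ := by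
          rw [← h1, ← Matrix.mul_assoc, Matrix.nonsing_inv_mul _ (isUnit_det_pencil _),
            Matrix.one_mul]
  ext j
  rw [transfer_apply, transfer_apply, hD]
  congr 1
  have hBj : S.B.col j = P *ᵥ S'.B.col j := by
    ext i
    rw [hB]
    rfl
  rw [resolventForm, resolventForm, hBj, ← C_mulVec, hC, ← C_vecMul, ← hφ, Matrix.mulVec_mulVec,
    h2, ← Matrix.mulVec_mulVec, Matrix.dotProduct_mulVec _ φ]

/-- A minimal realization is controllable. -/
theorem IsMinimalRealization.eq_zero_of_dotProduct {S : StateSpace m s} {G : Fin m → RatFunc ℝ}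
    (hS : S.IsMinimalRealization G) {v : Fin s → ℝ}
    (hv : ∀ (k : ℕ) (j : Fin m), v ⬝ᵥ (S.A ^ k *ᵥ S.B.col j) = 0) : v = 0 := by
  by_contra hv0
  -- The reachable subspace is invariant and lies in the hyperplane `v⊥`, so restricting the system
  -- to it yields a smaller realization of the same transfer function.
  let W : Submodule ℝ (Fin s → ℝ) :=
    Submodule.span ℝ (Set.range fun kj : ℕ × Fin m => S.A ^ kj.1 *ᵥ S.B.col kj.2)
  have hWA : ∀ x ∈ W, S.A *ᵥ x ∈ W := by
    intro x hx
    induction hx using Submodule.span_induction with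
    | mem x hx =>
      obtain ⟨⟨k, j⟩, rfl⟩ := hx
      refine Submodule.subset_span ⟨(k + 1, j), ?_⟩
      simp [Matrix.mulVec_mulVec, pow_succ']
    | zero => simp
    | add x y _ _ hx hy => rw [Matrix.mulVec_add]; exact W.add_mem hx hy
    | smul a x _ hx => rw [Matrix.mulVec_smul]; exact W.smul_mem a hx
  have hWB : ∀ j, S.B.col j ∈ W := fun j => Submodule.subset_span ⟨(0, j), by simp⟩
  have hWv : ∀ x ∈ W, v ⬝ᵥ x = 0 := by
    intro x hx
    induction hx using Submodule.span_induction with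
    | mem x hx => obtain ⟨⟨k, j⟩, rfl⟩ := hx; exact hv k j
    | zero => simp
    | add x y _ _ hx hy => rw [dotProduct_add, hx, hy, add_zero]
    | smul a x _ hx => rw [dotProduct_smul, hx, smul_zero]
  have hlt : Module.finrank ℝ W < s := by
    have : W < ⊤ := by
      refine lt_top_iff_ne_top.mpr fun h => hv0 ?_
      have := hWv v (h ▸ Submodule.mem_top)
      exact dotProduct_self_eq_zero.mp this
    simpa using Submodule.finrank_lt_finrank_of_lt this
  let b := Module.finBasis ℝ W
  let P : Matrix (Fin s) (Fin (Module.finrank ℝ W)) ℝ := Matrix.of fun i k => (b k : Fin s → ℝ) i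
  have hP : ∀ x ∈ W, ∃ c, x = P *ᵥ c := by
    intro x hx
    refine ⟨b.repr ⟨x, hx⟩, ?_⟩
    have := congrArg (fun z : W => (z : Fin s → ℝ)) (b.sum_repr ⟨x, hx⟩)
    ext i
    have h2 := congrFun this i
    simp only [Submodule.coe_sum, Submodule.coe_smul, Finset.sum_apply, Pi.smul_apply,
      smul_eq_mul] at h2
    rw [← h2]
    simp [Matrix.mulVec, dotProduct, P, mul_comm]
  have hPcol : ∀ k, P.col k ∈ W := fun k => (b k).2
  choose a ha using fun k => hP _ (hWA _ (hPcol k))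
  choose β hβ using fun j => hP _ (hWB j)
  let S' : StateSpace m (Module.finrank ℝ W) :=
    ⟨Matrix.of fun i k => a k i, Matrix.of fun i j => β j i, S.C ᵥ* P, S.D⟩
  have hS' : S'.transfer = S.transfer := by
    refine transfer_eq_of_intertwine S S' P ?_ ?_ rfl rfl
    · ext i k
      exact congrFun (ha k) i
    · ext i j
      exact congrFun (hβ j) i
  exact absurd (hS.2 _ S' (hS'.trans hS.1)) (not_le.mpr hlt)

/-- The denominator of a minimal realization annihilates the observability rows. -/
theorem IsMinimalRealization.vecMul_aeval_eq_zero {S : StateSpace m s} {G : Fin m → RatFunc ℝ}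
    (hS : S.IsMinimalRealization G) {D : ℝ[X]} {Nm : Fin m → ℝ[X]}
    (h : ∀ j, algebraMap ℝ[X] (RatFunc ℝ) D * G j = algebraMap ℝ[X] (RatFunc ℝ) (Nm j)) :
    S.C ᵥ* aeval S.A D = 0 := by
  refine hS.eq_zero_of_dotProduct fun k j => ?_
  have h1 := mul_resolventForm S.A S.C (S.B.col j) (S.D j) D
  rw [← transfer_apply, hS.1, h j] at h1
  -- Since `D * G` is polynomial, so is the remainder form of `C D(A)`. Its Markov parameters
  -- therefore vanish, and controllability finishes.
  have h2 : resolventForm S.A (S.C ᵥ* aeval S.A D) (S.B.col j) =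
      algebraMap ℝ[X] (RatFunc ℝ) (Nm j - polyPartMul S.A S.C (S.B.col j) (S.D j) D) := by
    rw [map_sub, h1, add_sub_cancel_left]
  rw [Matrix.dotProduct_mulVec]
  exact markov_eq_zero k h2

end StateSpace

/-! ### Trajectories -/

/-- The linear functional `∑ aₖ z ^ k ↦ ∑ aₖ wₖ`. -/
def seqEval (w : ℕ → ℝ) : ℝ[X] →ₗ[ℝ] ℝ :=
  Polynomial.lsum fun k => w k • LinearMap.id

theorem seqEval_apply (w : ℕ → ℝ) (p : ℝ[X]) : seqEval w p = p.sum fun k a => a * w k := by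
  simp [seqEval, Polynomial.lsum_apply, mul_comm]

theorem seqEval_C (w : ℕ → ℝ) (a : ℝ) : seqEval w (C a) = a * w 0 := by
  rw [seqEval_apply, sum_C_index]
  simp

theorem seqEval_X_mul (w : ℕ → ℝ) (p : ℝ[X]) :
    seqEval w (X * p) = seqEval (fun k => w (k + 1)) p := by
  induction p using Polynomial.induction_on' with
  | add p q hp hq => rw [mul_add, map_add, map_add, hp, hq]
  | monomial k a => rw [X_mul_monomial, seqEval_apply, seqEval_apply,
      sum_monomial_index _ _ (by simp), sum_monomial_index _ _ (by simp)]

theorem seqEval_eq_sum_range (w : ℕ → ℝ) {p : ℝ[X]} {K : ℕ} (hp : p.natDegree < K) :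
    seqEval w p = ∑ k ∈ Finset.range K, p.coeff k * w k := by
  rw [seqEval_apply, sum_over_range' _ (by simp) _ hp]

namespace StateSpace

variable {m s : ℕ}

/-- Variation of constants, with the convolution kernel stored in the same `polyPart` that occurs in
the transfer function. The induction shifts time by one and absorbs the first step into the initial
state. -/
theorem output_eq (S : StateSpace m s) (k : ℕ) :
    ∀ (x : ℕ → Fin s → ℝ) (u : ℕ → Fin m → ℝ),
      (∀ t, x (t + 1) = S.A *ᵥ x t + S.B *ᵥ u t) →
      S.C ⬝ᵥ x k + S.D ⬝ᵥ u k = (S.C ᵥ* S.A ^ k) ⬝ᵥ x 0 +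
        ∑ j, seqEval (fun t => u t j) (polyPart S.A S.C (S.B.col j) (S.D j) k) := by
  induction k with
  | zero =>
    intro x u _
    simp [polyPart, seqEval_C, dotProduct]
  | succ k ih =>
    intro x u h
    have h1 := ih (fun t => x (t + 1)) (fun t => u (t + 1)) (fun t => h (t + 1))
    rw [h1, h 0, dotProduct_add, Matrix.dotProduct_mulVec, Matrix.vecMul_vecMul, ← pow_succ,
      add_assoc]
    congr 1
    simp only [polyPart, map_add, seqEval_X_mul, seqEval_C, Finset.sum_add_distrib]
    rw [add_comm]
    congr 1
    rw [Matrix.dotProduct_mulVec]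
    rfl

theorem seqEval_output (S : StateSpace m s) (x : ℕ → Fin s → ℝ) (u : ℕ → Fin m → ℝ)
    (h : ∀ t, x (t + 1) = S.A *ᵥ x t + S.B *ᵥ u t) (p : ℝ[X]) :
    seqEval (fun t => S.C ⬝ᵥ x t + S.D ⬝ᵥ u t) p = (S.C ᵥ* aeval S.A p) ⬝ᵥ x 0 +
      ∑ j, seqEval (fun t => u t j) (polyPartMul S.A S.C (S.B.col j) (S.D j) p) := by
  rw [seqEval_apply, aeval_vecMul]
  simp only [polyPartMul, Polynomial.sum, map_sum, sum_dotProduct, smul_dotProduct]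
  rw [Finset.sum_comm, ← Finset.sum_add_distrib]
  refine Finset.sum_congr rfl fun k _ => ?_
  rw [S.output_eq k x u h, mul_add, smul_eq_mul, Finset.mul_sum]
  simp only [← smul_eq_C_mul, map_smul, smul_eq_mul]

/-- An annihilating polynomial of the transfer function and of the observability rows gives a
difference equation for the trajectories. -/
theorem IsTrajectory.sum_eq {S : StateSpace m s} {K : ℕ} {u : Fin K → Fin m → ℝ} {y : Fin K → ℝ}
    (h : S.IsTrajectory u y) {p : ℝ[X]} {q : Fin m → ℝ[X]} (hp : p.natDegree < K)
    (hq : ∀ j, (q j).natDegree < K) (hC : S.C ᵥ* aeval S.A p = 0)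
    (hpq : ∀ j, algebraMap ℝ[X] (RatFunc ℝ) p * S.transfer j =
      algebraMap ℝ[X] (RatFunc ℝ) (q j)) :
    ∑ k : Fin K, p.coeff k * y k = ∑ j, ∑ k : Fin K, (q j).coeff k * u k j := by
  obtain ⟨x, hx, hy⟩ := h
  -- The finite trajectory is prolonged by zero input so that the recursion runs over all of `ℕ`;
  -- the degree bounds keep the added part out of the sums.
  let u' : ℕ → Fin m → ℝ := fun t => if ht : t < K then u ⟨t, ht⟩ else 0
  let x' : ℕ → Fin s → ℝ := fun t => Nat.rec (x 0) (fun t z => S.A *ᵥ z + S.B *ᵥ u' t) t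
  have hx' : ∀ t, x' (t + 1) = S.A *ᵥ x' t + S.B *ᵥ u' t := fun t => rfl
  have hu : ∀ k : Fin K, u' k = u k := fun k => by simp [u']
  have hxx : ∀ (t : ℕ) (ht : t < K + 1), x' t = x ⟨t, ht⟩ := by
    intro t
    induction t with
    | zero => exact fun _ => rfl
    | succ t ih =>
      intro ht
      have h1 := hx ⟨t, by omega⟩
      rw [hx', ih (by omega), hu ⟨t, by omega⟩]
      exact h1.symm
  have hq' : ∀ j, polyPartMul S.A S.C (S.B.col j) (S.D j) p = q j := by
    intro j
    have h1 := mul_resolventForm S.A S.C (S.B.col j) (S.D j) p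
    rw [← transfer_apply, hpq j, hC, resolventForm_zero_left, add_zero] at h1
    exact (RatFunc.algebraMap_injective ℝ h1).symm
  have h1 := S.seqEval_output x' u' hx' p
  rw [hC, zero_dotProduct, zero_add, seqEval_eq_sum_range _ hp, ← Fin.sum_univ_eq_sum_range
    (fun k => p.coeff k * (S.C ⬝ᵥ x' k + S.D ⬝ᵥ u' k))] at h1
  have h2 : ∀ k : Fin K, S.C ⬝ᵥ x' k + S.D ⬝ᵥ u' k = y k := by
    intro k
    rw [hy k, hu, hxx k (by omega)]
    rfl
  simp only [h2] at h1
  rw [h1]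
  refine Finset.sum_congr rfl fun j _ => ?_
  rw [hq' j, seqEval_eq_sum_range _ (hq j), ← Fin.sum_univ_eq_sum_range
    (fun k => (q j).coeff k * u' k j)]
  simp only [hu]

end StateSpace

end DataDriven

end

namespace DataDriven

open Polynomial Filter Topology

/-! ### Continuity of the roots of a polynomial -/

section Roots

variable {ι : Type*} [Fintype ι]

/-- Equal multiplicities mean fibres of equal cardinality, which are matched one by one. -/
theorem exists_equiv_of_map_univ_eq {α : Type*} {f g : ι → α}
    (h : Finset.univ.val.map f = Finset.univ.val.map g) : ∃ σ : ι ≃ ι, ∀ i, f (σ i) = g i := by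
  classical
  have hcard : ∀ y, Fintype.card {i // g i = y} = Fintype.card {i // f i = y} := by
    intro y
    have := congrArg (Multiset.count y) h
    rw [Multiset.count_map, Multiset.count_map] at this
    rw [Fintype.card_subtype, Fintype.card_subtype]
    simp only [Finset.card, Finset.filter_val, eq_comm] at this ⊢
    exact this
  exact ⟨Equiv.ofFiberEquiv fun y => Fintype.equivOfCardEq (hcard y),
    fun i => Equiv.ofFiberEquiv_map _ i⟩

theorem exists_eq_prod_X_sub_C {P : ℂ[X]} (hP : P.Monic) (hd : P.natDegree = Fintype.card ι) :
    ∃ r : ι → ℂ, P = ∏ i, (X - C (r i)) := by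
  have hs := IsAlgClosed.splits P
  have hcard : P.roots.card = Fintype.card ι := by rw [splits_iff_card_roots.mp hs, hd]
  have hprod : (P.roots.map fun a => X - C a).prod = P :=
    prod_multiset_X_sub_C_of_monic_of_roots_card_eq hP (splits_iff_card_roots.mp hs)
  obtain ⟨L, hL⟩ := Quotient.exists_rep P.roots
  have hL' : (L : Multiset ℂ) = P.roots := hL
  have hlen : L.length = Fintype.card ι := by rw [← hcard, ← hL', Multiset.coe_card]
  let e : ι ≃ Fin L.length := (Fintype.equivFin ι).trans (finCongr hlen.symm)
  refine ⟨fun i => L.get (e i), ?_⟩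
  rw [Equiv.prod_comp e fun k => X - C (L.get k), ← hprod, ← hL', Multiset.map_coe,
    Multiset.prod_coe]
  exact (Fin.prod_univ_fun_getElem L fun a => X - C a).symm

/-- A weakening of the Cauchy bound that is visibly continuous in the coefficients. -/
theorem norm_root_le {P : ℂ[X]} (hP : P.Monic) {z : ℂ} (hz : P.IsRoot z) :
    ‖z‖ ≤ ∑ k ∈ Finset.range P.natDegree, ‖P.coeff k‖ + 1 := by
  have h := (hz.norm_lt_cauchyBound hP.ne_zero).le
  have h2 : P.cauchyBound ≤ ∑ k ∈ Finset.range P.natDegree, ‖P.coeff k‖₊ + 1 := by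
    rw [cauchyBound, hP.leadingCoeff, nnnorm_one, div_one]
    gcongr
    exact Finset.sup_le fun k hk => Finset.single_le_sum (f := fun k => ‖P.coeff k‖₊)
      (fun _ _ => zero_le) hk
  have h3 := h.trans h2
  rw [← NNReal.coe_le_coe] at h3
  simpa using h3

/-- The roots of a monic polynomial, listed with multiplicity, depend continuously on the
coefficients. -/
theorem eventually_exists_roots_mem {Y : Type*} {l : Filter Y} {P : Y → ℂ[X]}
    (hmonic : ∀ t, (P t).Monic) (hdeg : ∀ t, (P t).natDegree = Fintype.card ι) {r : ι → ℂ}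
    (hlim : ∀ k, Tendsto (fun t => (P t).coeff k) l (𝓝 ((∏ i, (X - C (r i))).coeff k)))
    {V : ι → Set ℂ} (hV : ∀ i, V i ∈ 𝓝 (r i)) :
    ∀ᶠ t in l, ∃ r' : ι → ℂ, P t = ∏ i, (X - C (r' i)) ∧ ∀ i, r' i ∈ V i := by
  choose ρ hρ using fun t => exists_eq_prod_X_sub_C (ι := ι) (hmonic t) (hdeg t)
  -- Along an ultrafilter an arbitrary choice `ρ` of root listings converges once bounded, so no
  -- continuous selection of roots is needed.
  refine mem_iff_ultrafilter.mpr fun U hUl => ?_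
  set Q : ℂ[X] := ∏ i, (X - C (r i)) with hQ
  have hQd : Q.natDegree = Fintype.card ι := by simp [hQ]
  have hlimU : ∀ k, Tendsto (fun t => (P t).coeff k) U (𝓝 (Q.coeff k)) :=
    fun k => (hlim k).mono_left hUl
  obtain ⟨B, hB⟩ : ∃ B : ℝ, ∀ᶠ t in (U : Filter Y), ρ t ∈ Metric.closedBall (0 : ι → ℂ) B := by
    have h1 : Tendsto (fun t => ∑ k ∈ Finset.range (Fintype.card ι), ‖(P t).coeff k‖ + 1) U
        (𝓝 (∑ k ∈ Finset.range (Fintype.card ι), ‖Q.coeff k‖ + 1)) :=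
      (tendsto_finsetSum _ fun k _ => (hlimU k).norm).add_const 1
    refine ⟨∑ k ∈ Finset.range (Fintype.card ι), ‖Q.coeff k‖ + 1 + 1, ?_⟩
    filter_upwards [h1.eventually (gt_mem_nhds (lt_add_one _))] with t ht
    rw [mem_closedBall_zero_iff, pi_norm_le_iff_of_nonneg (by positivity)]
    intro i
    refine (norm_root_le (hmonic t) (z := ρ t i) ?_).trans ?_
    · rw [IsRoot.def, hρ t, eval_prod]
      exact Finset.prod_eq_zero (Finset.mem_univ i) (by simp)
    · rw [hdeg t]
      exact ht.le
  obtain ⟨ρ₀, -, hρ₀⟩ := (isCompact_closedBall (0 : ι → ℂ) B).ultrafilter_le_nhds' (U.map ρ) hB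
  have hρ₀' : Tendsto ρ U (𝓝 ρ₀) := hρ₀
  have heq : ∏ i, (X - C (ρ₀ i)) = Q := by
    refine Polynomial.funext fun z => ?_
    have h1 : Tendsto (fun t => (P t).eval z) U (𝓝 (Q.eval z)) := by
      simp only [eval_eq_sum_range, hdeg, hQd]
      exact tendsto_finsetSum _ fun k _ => (hlimU k).mul_const _
    have h2 : Tendsto (fun t => (P t).eval z) U (𝓝 ((∏ i, (X - C (ρ₀ i))).eval z)) := by
      have : ∀ t, (P t).eval z = ∏ i, (z - ρ t i) := by
        intro t
        nth_rewrite 1 [hρ t]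
        simp [eval_prod]
      simp only [this, eval_prod, eval_sub, eval_X, eval_C]
      exact tendsto_finsetProd _ fun i _ => ((tendsto_pi_nhds.mp hρ₀') i).const_sub z
    exact tendsto_nhds_unique h2 h1
  have hroots : Finset.univ.val.map ρ₀ = Finset.univ.val.map r := by
    have h1 : ∀ f : ι → ℂ, (∏ i, (X - C (f i))).roots = Finset.univ.val.map f := by
      intro f
      rw [← roots_multiset_prod_X_sub_C (Finset.univ.val.map f), Multiset.map_map]
      rfl
    rw [← h1, ← h1, heq]
  -- The limit listing has the right roots but possibly in another order; relabelling by `σ` repairs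
  -- this.
  obtain ⟨σ, hσ⟩ := exists_equiv_of_map_univ_eq hroots
  have hev : ∀ᶠ t in (U : Filter Y), ∀ i, ρ t (σ i) ∈ V i := by
    rw [eventually_all]
    intro i
    have := (tendsto_pi_nhds.mp hρ₀') (σ i)
    rw [hσ i] at this
    exact this.eventually (hV i)
  filter_upwards [hev] with t ht
  refine ⟨fun i => ρ t (σ i), ?_, ht⟩
  rw [Equiv.prod_comp σ fun i => X - C (ρ t i)]
  exact hρ t

end Roots

end DataDriven

namespace DataDriven

open Filter Topology

/-! ### Continuity of the truncated Moore–Penrose inverse -/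

section TruncPinv

theorem l2_opNorm_le_one_of_orthonormal {ι : Type*} [Fintype ι] {r : ℕ}
    {U : Matrix ι (Fin r) ℝ} (hU : Uᵀ * U = 1) :
    ‖U‖ ≤ 1 := by
  have h := Matrix.l2_opNorm_conjTranspose_mul_self U
  rw [Matrix.conjTranspose_eq_transpose_of_trivial, hU, ← Matrix.diagonal_one,
    Matrix.l2_opNorm_diagonal] at h
  have h1 : ‖fun _ : Fin r => (1 : ℝ)‖ ≤ 1 :=
    (pi_norm_le_iff_of_nonneg zero_le_one).mpr fun _ => by simp
  nlinarith [norm_nonneg U]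

variable {ι κ : Type*} [Fintype ι] [Fintype κ] [DecidableEq ι] [DecidableEq κ]

theorem l2_opNorm_transpose (M : Matrix ι κ ℝ) : ‖Mᵀ‖ = ‖M‖ := by
  rw [← Matrix.conjTranspose_eq_transpose_of_trivial, Matrix.l2_opNorm_conjTranspose]

theorem l2_opNorm_mul_diagonal_mul_le {ι : Type*} [Fintype ι] {r : ℕ}
    {U : Matrix ι (Fin r) ℝ} {V : Matrix κ (Fin r) ℝ}
    (hU : Uᵀ * U = 1) (hV : Vᵀ * V = 1) {d : Fin r → ℝ} {b : ℝ} (hb : 0 ≤ b)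
    (hd : ∀ k, |d k| ≤ b) : ‖U * Matrix.diagonal d * Vᵀ‖ ≤ b := by
  have h1 := l2_opNorm_le_one_of_orthonormal hU
  have h2 := l2_opNorm_le_one_of_orthonormal hV
  have h3 : ‖(Matrix.diagonal d : Matrix (Fin r) (Fin r) ℝ)‖ ≤ b := by
    rw [Matrix.l2_opNorm_diagonal]
    exact (pi_norm_le_iff_of_nonneg hb).mpr hd
  calc ‖U * Matrix.diagonal d * Vᵀ‖ ≤ ‖U‖ * ‖Matrix.diagonal d‖ * ‖Vᵀ‖ :=
        (Matrix.l2_opNorm_mul _ _).trans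
          (mul_le_mul_of_nonneg_right (Matrix.l2_opNorm_mul _ _) (norm_nonneg _))
    _ ≤ 1 * b * 1 := by
        rw [l2_opNorm_transpose]
        gcongr
    _ = b := by ring

/-- These relations are closed conditions on the pair, and the last bound gives compactness, so all
survive the limit in `tendsto_truncPinv`. Only `M X M = M` fails, with an error of at most `τ`. -/
theorem truncPinv_properties {τ : ℝ} (hτ : 0 < τ) (M : Matrix ι κ ℝ) :
    truncPinv τ M * M * truncPinv τ M = truncPinv τ M ∧
      (M * truncPinv τ M)ᵀ = M * truncPinv τ M ∧ (truncPinv τ M * M)ᵀ = truncPinv τ M * M ∧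
      ‖M - M * truncPinv τ M * M‖ ≤ τ ∧ ‖truncPinv τ M‖ ≤ τ⁻¹ := by
  obtain ⟨r, U, σ, V, ⟨hU, hV, hσ, hM⟩, hX⟩ := truncPinv_spec τ M
  set X := truncPinv τ M
  set g : Fin r → ℝ := fun k => if τ < σ k then (σ k)⁻¹ else 0 with hg
  have hMX : M * X = U * Matrix.diagonal (fun k => σ k * g k) * Uᵀ := by
    calc M * X = U * (Matrix.diagonal σ * (Vᵀ * V) * Matrix.diagonal g) * Uᵀ := by
          rw [hX, hM]
          simp only [Matrix.mul_assoc]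
      _ = _ := by rw [hV, Matrix.mul_one, Matrix.diagonal_mul_diagonal]
  have hXM : X * M = V * Matrix.diagonal (fun k => g k * σ k) * Vᵀ := by
    calc X * M = V * (Matrix.diagonal g * (Uᵀ * U) * Matrix.diagonal σ) * Vᵀ := by
          rw [hX, hM]
          simp only [Matrix.mul_assoc]
      _ = _ := by rw [hU, Matrix.mul_one, Matrix.diagonal_mul_diagonal]
  have hMXM : M * X * M = U * Matrix.diagonal (fun k => σ k * g k * σ k) * Vᵀ := by
    calc M * X * M = U * (Matrix.diagonal (fun k => σ k * g k) * (Uᵀ * U) *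
            Matrix.diagonal σ) * Vᵀ := by
          rw [hMX, hM]
          simp only [Matrix.mul_assoc]
      _ = _ := by rw [hU, Matrix.mul_one, Matrix.diagonal_mul_diagonal]
  have hXMX : X * M * X = V * Matrix.diagonal (fun k => g k * σ k * g k) * Uᵀ := by
    calc X * M * X = V * (Matrix.diagonal (fun k => g k * σ k) * (Vᵀ * V) *
            Matrix.diagonal g) * Uᵀ := by
          rw [hXM, hX]
          simp only [Matrix.mul_assoc]
      _ = _ := by rw [hV, Matrix.mul_one, Matrix.diagonal_mul_diagonal]
  refine ⟨?_, ?_, ?_, ?_, ?_⟩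
  · rw [hXMX, hX]
    congr 3
    funext k
    by_cases h : τ < σ k
    · have : σ k ≠ 0 := (hτ.trans h).ne'
      simp [hg, h, this]
    · simp [hg, h]
  · rw [hMX]
    simp [Matrix.transpose_mul, Matrix.mul_assoc]
  · rw [hXM]
    simp [Matrix.transpose_mul, Matrix.mul_assoc]
  · have : M - M * X * M = U * Matrix.diagonal (fun k => σ k - σ k * g k * σ k) * Vᵀ := by
      rw [hMXM]
      nth_rewrite 1 [hM]
      rw [← Matrix.sub_mul, ← Matrix.mul_sub, Matrix.diagonal_sub]
    rw [this]
    refine l2_opNorm_mul_diagonal_mul_le hU hV hτ.le fun k => ?_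
    by_cases h : τ < σ k
    · have : σ k ≠ 0 := (hτ.trans h).ne'
      simp [hg, h, this, hτ.le]
    · simp only [hg, h, if_false, mul_zero, zero_mul, sub_zero, abs_of_nonneg (hσ k)]
      exact not_lt.mp h
  · rw [hX]
    refine l2_opNorm_mul_diagonal_mul_le hV hU (by positivity) fun k => ?_
    by_cases h : τ < σ k
    · simp only [hg, h, if_true]
      rw [abs_of_pos (inv_pos.mpr (hτ.trans h))]
      exact inv_anti₀ hτ h.le
    · simp [hg, h, hτ.le]

theorem adjoint_comp_toEuclideanLin (M : Matrix ι κ ℝ) :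
    LinearMap.adjoint (Matrix.toEuclideanLin M) ∘ₗ Matrix.toEuclideanLin M =
      Matrix.toEuclideanLin (Mᵀ * M) := by
  rw [← Matrix.toEuclideanLin_conjTranspose_eq_adjoint,
    Matrix.conjTranspose_eq_transpose_of_trivial]
  exact (Matrix.toLpLin_mul_same 2 Mᵀ M).symm

theorem sigmaMin_le {M : Matrix ι κ ℝ} {s : ℝ} (hs : 0 < s)
    (h : Module.End.HasEigenvalue (Matrix.toEuclideanLin (Mᵀ * M)) (s ^ 2)) : sigmaMin M ≤ s := by
  rw [← adjoint_comp_toEuclideanLin] at h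
  obtain ⟨i, hi⟩ := (Matrix.toEuclideanLin M).isSymmetric_adjoint_comp_self.exists_eigenvalues_eq
    rfl h
  refine csInf_le ⟨0, ?_⟩ ⟨hs.ne', i, ?_⟩
  · rintro _ ⟨-, j, rfl⟩
    exact LinearMap.singularValues_nonneg _ j
  · rw [LinearMap.singularValues_fin _ rfl i, show LinearMap.IsSymmetric.eigenvalues _ _ i = s ^ 2
      from hi, Real.sqrt_sq hs.le]

/-- A generalized inverse whose residual is smaller than the smallest nonzero singular value is
the Moore–Penrose inverse. -/
theorem eq_pinv_of_norm_residual_lt {M : Matrix ι κ ℝ} {X : Matrix κ ι ℝ}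
    (h1 : X * M * X = X) (h2 : (M * X)ᵀ = M * X) (h3 : (X * M)ᵀ = X * M)
    (h4 : ‖M - M * X * M‖ < sigmaMin M) : X = pinv M := by
  obtain ⟨S, hS⟩ : ∃ S, S = M - M * X * M := ⟨_, rfl⟩
  suffices h0 : S = 0 from
    IsMoorePenrose.unique ⟨(sub_eq_zero.mp (hS.symm.trans h0)).symm, h1, h2, h3⟩ (pinv_spec M)
  rw [← hS] at h4
  by_contra hne
  have hXS : X * S = 0 := by
    rw [hS, Matrix.mul_sub, ← Matrix.mul_assoc, ← Matrix.mul_assoc, h1, sub_self]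
  have hSX : S * X = 0 := by
    rw [hS, Matrix.sub_mul, Matrix.mul_assoc M X M, Matrix.mul_assoc M (X * M) X, h1, sub_self]
  -- The part `M X M` of `M` is orthogonal to the residual `S` on both sides, so singular vectors of
  -- `S` for nonzero singular values are singular vectors of `M` with the same values.
  have hMS : Mᵀ * S = Sᵀ * S := by
    have : (M * X * M)ᵀ * S = 0 := by
      rw [Matrix.transpose_mul, h2, Matrix.mul_assoc, Matrix.mul_assoc M, hXS, Matrix.mul_zero,
        Matrix.mul_zero]
    nth_rewrite 2 [hS]
    rw [Matrix.transpose_sub, Matrix.sub_mul, this, sub_zero]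
  have hQS : X * M * Sᵀ = 0 := by
    rw [← h3, ← Matrix.transpose_mul, ← Matrix.mul_assoc, hSX, Matrix.zero_mul,
      Matrix.transpose_zero]
  have hMM : Mᵀ * M * Sᵀ = Sᵀ * S * Sᵀ := by
    have : M * Sᵀ = S * Sᵀ := by
      rw [hS, Matrix.sub_mul, ← hS, Matrix.mul_assoc M, Matrix.mul_assoc M, hQS, Matrix.mul_zero,
        sub_zero]
    rw [Matrix.mul_assoc, this, ← Matrix.mul_assoc, hMS]
  set f := Matrix.toEuclideanLin S with hf
  have hf0 : f ≠ 0 := by simpa [hf] using hne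
  have hrange : 0 < Module.finrank ℝ f.range := by
    rw [Module.finrank_pos_iff_exists_ne_zero]
    by_contra hcon
    push Not at hcon
    refine hf0 (LinearMap.ext fun x => ?_)
    simpa using congrArg Subtype.val (hcon ⟨f x, x, rfl⟩)
  have hs : 0 < f.singularValues 0 := f.singularValues_pos_iff_lt_finrank_range.mpr hrange
  set s := f.singularValues 0
  have hev : Module.End.HasEigenvalue (Matrix.toEuclideanLin (Sᵀ * S)) (s ^ 2) := by
    rw [← adjoint_comp_toEuclideanLin]
    exact f.hasEigenvalue_adjoint_comp_self_sq_singularValues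
      (hrange.trans_le (LinearMap.finrank_range_le f))
  obtain ⟨v, hv⟩ := hev.exists_hasEigenvector
  have hSv : (Sᵀ * S) *ᵥ v.ofLp = s ^ 2 • v.ofLp := by
    have := congrArg WithLp.ofLp hv.apply_eq_smul
    simpa using this
  have hMv : (Mᵀ * M) *ᵥ v.ofLp = s ^ 2 • v.ofLp := by
    have h5 : (Mᵀ * M) *ᵥ (s ^ 2 • v.ofLp) = s ^ 2 • s ^ 2 • v.ofLp := by
      nth_rewrite 1 [← hSv]
      rw [Matrix.mulVec_mulVec, ← Matrix.mul_assoc, hMM, Matrix.mul_assoc,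
        ← Matrix.mulVec_mulVec, hSv, Matrix.mulVec_smul, hSv]
    rw [Matrix.mulVec_smul] at h5
    exact smul_right_injective _ (pow_ne_zero 2 hs.ne') h5
  have hle : sigmaMin M ≤ s := by
    refine sigmaMin_le hs (Module.End.hasEigenvalue_of_hasEigenvector (x := v) ⟨?_, hv.2⟩)
    rw [Module.End.mem_eigenspace_iff]
    refine WithLp.ofLp_injective 2 ?_
    simpa using hMv
  have hsS : s ≤ ‖S‖ := by
    have h5 : ‖f v‖ ^ 2 = s ^ 2 * ‖v‖ ^ 2 := by
      have h6 : inner ℝ (f v) (f v) = inner ℝ ((LinearMap.adjoint f ∘ₗ f) v) v := by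
        rw [LinearMap.comp_apply, LinearMap.adjoint_inner_left]
      rw [adjoint_comp_toEuclideanLin, hv.apply_eq_smul, real_inner_smul_left,
        real_inner_self_eq_norm_sq, real_inner_self_eq_norm_sq] at h6
      exact h6
    have h7 : ‖f v‖ ≤ ‖S‖ * ‖v‖ := Matrix.l2_opNorm_mulVec S v
    have hv0 : 0 < ‖v‖ := norm_pos_iff.mpr hv.2
    have h8 : s * ‖v‖ = ‖f v‖ := by
      rw [← mul_pow] at h5
      exact ((pow_left_inj₀ (norm_nonneg _) (by positivity) two_ne_zero).mp h5).symm
    exact le_of_mul_le_mul_right (h8.trans_le h7) hv0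
  exact absurd (h4.trans_le hle) (not_lt.mpr hsS)

/-- The values stay in a compact ball, so it is enough to identify cluster points. No perturbation
theory of singular vectors is needed. -/
theorem tendsto_truncPinv {τ : ℝ} (hτ : 0 < τ) {M : Matrix ι κ ℝ} (hM : τ < sigmaMin M) :
    Tendsto (truncPinv τ) (𝓝 M) (𝓝 (pinv M)) := by
  have : ProperSpace (Matrix κ ι ℝ) := FiniteDimensional.proper_real _
  refine (isCompact_closedBall (0 : Matrix κ ι ℝ) τ⁻¹).tendsto_nhds_of_unique_mapClusterPt
    (Eventually.of_forall fun A => mem_closedBall_zero_iff.mpr (truncPinv_properties hτ A).2.2.2.2)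
    fun X _ hX => ?_
  obtain ⟨U, hU, hUX⟩ := mapClusterPt_iff_ultrafilter.mp hX
  have hUM : Tendsto (fun A : Matrix ι κ ℝ => A) U (𝓝 M) := hU
  have hprod : Tendsto (fun A => (A, truncPinv τ A)) U (𝓝 (M, X)) := hUM.prodMk_nhds hUX
  have lim : ∀ {K : Set (Matrix ι κ ℝ × Matrix κ ι ℝ)}, IsClosed K →
      (∀ A, (A, truncPinv τ A) ∈ K) → (M, X) ∈ K := fun hK h =>
    hK.mem_of_tendsto hprod (Eventually.of_forall h)
  refine eq_pinv_of_norm_residual_lt ?_ ?_ ?_ (lt_of_le_of_lt ?_ hM)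
  · exact lim (K := {Z | Z.2 * Z.1 * Z.2 = Z.2}) (isClosed_eq (by fun_prop) (by fun_prop))
      fun A => (truncPinv_properties hτ A).1
  · exact lim (K := {Z | (Z.1 * Z.2)ᵀ = Z.1 * Z.2}) (isClosed_eq (by fun_prop) (by fun_prop))
      fun A => (truncPinv_properties hτ A).2.1
  · exact lim (K := {Z | (Z.2 * Z.1)ᵀ = Z.2 * Z.1}) (isClosed_eq (by fun_prop) (by fun_prop))
      fun A => (truncPinv_properties hτ A).2.2.1
  · exact lim (K := {Z | ‖Z.1 - Z.1 * Z.2 * Z.1‖ ≤ τ}) (isClosed_le (by fun_prop) (by fun_prop))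
      fun A => (truncPinv_properties hτ A).2.2.2.1

end TruncPinv

end DataDriven

noncomputable section

namespace DataDriven

open Polynomial

/-! ### Roots of orthogonal polynomials -/

section Schur

variable {ι : Type*} [Fintype ι]

/-- The coefficients, up to degree `K`, of the multiples `F * M i` of the polynomials `M i`. -/
def coeffVec (M : ι → ℂ[X]) (K : ℕ) : ℂ[X] →ₗ[ℂ] EuclideanSpace ℂ (ι × Fin (K + 1)) where
  toFun F := WithLp.toLp 2 fun ik => (F * M ik.1).coeff ik.2
  map_add' F F' := by ext ik; simp [add_mul]
  map_smul' a F := by ext ik; simp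

/-- Multiplication by `X` shifts the coefficients; the hypothesis says that none falls off the
window. -/
theorem norm_coeffVec_X_mul {M : ι → ℂ[X]} {K : ℕ} {F : ℂ[X]}
    (hF : ∀ i, (F * M i).coeff K = 0) : ‖coeffVec M K (X * F)‖ = ‖coeffVec M K F‖ := by
  rw [EuclideanSpace.norm_eq, EuclideanSpace.norm_eq, Fintype.sum_prod_type, Fintype.sum_prod_type]
  congr 1
  refine Finset.sum_congr rfl fun i _ => ?_
  rw [Fin.sum_univ_succ, Fin.sum_univ_castSucc]
  simp [coeffVec, mul_assoc, hF, coeff_X_mul]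

/-- A monic polynomial `P` of degree `d` orthogonal, in the weighted coefficient inner product
given by the polynomials `M i`, to all polynomials of smaller degree has its roots in the open unit
disc. -/
theorem isSchur_of_orthogonal {P : ℝ[X]} {d n : ℕ} (hP : P.Monic) (hd : P.natDegree = d)
    {M : ι → ℝ[X]} (hM : ∀ i, (M i).natDegree ≤ n) {i₀ : ι} (hM₀ : (M i₀).Monic)
    (hM₀d : (M i₀).natDegree = n)
    (horth : ∀ k < d, ∑ i, ∑ t : Fin (d + n + 1),
      (P * M i).coeff t * (X ^ k * M i).coeff t = 0) : IsSchur P := by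
  intro z hz
  set Q := P.map (algebraMap ℝ ℂ) with hQ
  set M' : ι → ℂ[X] := fun i => (M i).map (algebraMap ℝ ℂ) with hM'
  have hQm : Q.Monic := hP.map _
  have hroot : Q.IsRoot z := by
    rwa [IsRoot.def, hQ, eval_map_algebraMap]
  obtain ⟨R, hR⟩ := dvd_iff_isRoot.mpr hroot
  have hR0 : R ≠ 0 := by
    rintro rfl
    exact hQm.ne_zero (by simpa using hR)
  have hRd : R.natDegree + 1 = d := by
    have := congrArg natDegree hR
    rw [natDegree_mul (X_sub_C_ne_zero z) hR0, natDegree_X_sub_C, hQ,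
      hP.natDegree_map, hd] at this
    omega
  set Ψ := coeffVec M' (d + n) with hΨ
  have hX : ∀ k < d, inner ℂ (Ψ (X ^ k)) (Ψ Q) = 0 := by
    intro k hk
    have h1 := congrArg (algebraMap ℝ ℂ) (horth k hk)
    rw [map_zero, map_sum] at h1
    rw [PiLp.inner_apply, Fintype.sum_prod_type, ← h1]
    refine Finset.sum_congr rfl fun i _ => ?_
    rw [map_sum]
    refine Finset.sum_congr rfl fun t _ => ?_
    have e1 : Ψ Q (i, t) = ((P * M i).coeff t : ℂ) := by
      change (Q * M' i).coeff t = _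
      rw [hQ, hM', ← Polynomial.map_mul, coeff_map]
      rfl
    have e2 : Ψ (X ^ k) (i, t) = ((X ^ k * M i).coeff t : ℂ) := by
      change (X ^ k * M' i).coeff t = _
      rw [hM', ← Polynomial.map_X (algebraMap ℝ ℂ), ← Polynomial.map_pow, ← Polynomial.map_mul,
        coeff_map]
      rfl
    rw [e1, e2]
    simp
  have hRQ : inner ℂ (Ψ R) (Ψ Q) = 0 := by
    rw [R.as_sum_range_C_mul_X_pow, map_sum, sum_inner]
    refine Finset.sum_eq_zero fun k hk => ?_
    rw [← smul_eq_C_mul, map_smul, inner_smul_left, hX k (by rw [Finset.mem_range] at hk; omega),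
      mul_zero]
  have hshift : ‖Ψ (X * R)‖ = ‖Ψ R‖ := by
    refine norm_coeffVec_X_mul fun i => coeff_eq_zero_of_natDegree_lt ?_
    have h1 : (M' i).natDegree ≤ n := natDegree_map_le.trans (hM i)
    have h2 : (R * M' i).natDegree ≤ _ := natDegree_mul_le
    omega
  have hdecomp : Ψ (X * R) = Ψ Q + z • Ψ R := by
    rw [← map_smul, ← map_add, hR, smul_eq_C_mul]
    congr 1
    ring
  -- The shift isometry on the left, Pythagoras for `X * R = Q + z • R` on the right.
  have hpyth : ‖Ψ R‖ ^ 2 = ‖Ψ Q‖ ^ 2 + (‖z‖ * ‖Ψ R‖) ^ 2 := by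
    rw [← norm_smul, ← hshift, hdecomp, norm_add_sq (𝕜 := ℂ), inner_smul_right,
      ← inner_conj_symm, hRQ]
    simp
  -- The monic member `M i₀` keeps the top coefficient `1` inside the window, which makes the final
  -- inequality strict.
  have hQ0 : 0 < ‖Ψ Q‖ := by
    rw [norm_pos_iff]
    intro h0
    have h1 : (Q * M' i₀).coeff (d + n) = 0 :=
      congrArg (fun w : EuclideanSpace ℂ (ι × Fin (d + n + 1)) => w (i₀, Fin.last _)) h0
    have h2 : (Q * M' i₀).Monic := hQm.mul (hM₀.map _)
    have h3 : (Q * M' i₀).natDegree = d + n := by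
      rw [hQm.natDegree_mul (hM₀.map _), hP.natDegree_map, hM₀.natDegree_map, hd, hM₀d]
    rw [← h3, h2.coeff_natDegree] at h1
    exact one_ne_zero h1
  by_contra hz1
  have h1 : ‖Ψ R‖ ≤ ‖z‖ * ‖Ψ R‖ := le_mul_of_one_le_left (norm_nonneg _) (not_lt.mp hz1)
  have h2 : ‖Ψ R‖ ^ 2 ≤ (‖z‖ * ‖Ψ R‖) ^ 2 := pow_le_pow_left₀ (norm_nonneg _) h1 2
  have h3 : 0 < ‖Ψ Q‖ ^ 2 := by positivity
  linarith

end Schur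

/-! ### The left kernel of the data matrix -/

section DataMatrix

variable {m n N T : ℕ}

/-- The coefficients of `R * Nm` and `-R * D`, arranged as a predictor row. -/
def multipleRow (N : ℕ) (D : ℝ[X]) (Nm : Fin m → ℝ[X]) : ℝ[X] →ₗ[ℝ] (RegIndex m N → ℝ) where
  toFun R := Sum.elim (Sum.elim (fun kj => (R * Nm kj.2).coeff kj.1) fun j => (R * Nm j).coeff N)
    fun k => -(R * D).coeff k
  map_add' R R' := by
    ext ((k | j) | k) <;> simp [add_mul, add_comm]
  map_smul' a R := by
    ext ((k | j) | k) <;> simp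

theorem sum_regIndex (f : RegIndex m N → ℝ) :
    ∑ i, f i = ∑ j, (∑ k : Fin N, f (Sum.inl (Sum.inl (k, j))) + f (Sum.inl (Sum.inr j))) +
      ∑ k : Fin N, f (Sum.inr k) := by
  rw [Fintype.sum_sum_type, Fintype.sum_sum_type, Fintype.sum_prod_type, Finset.sum_comm,
    Finset.sum_add_distrib]

theorem IsFraction.mul_eq {G : Fin m → RatFunc ℝ} {D : ℝ[X]} {Nm : Fin m → ℝ[X]}
    (hG : IsFraction G n D Nm) (j : Fin m) :
    algebraMap ℝ[X] (RatFunc ℝ) D * G j = algebraMap ℝ[X] (RatFunc ℝ) (Nm j) := by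
  rw [hG.2.2.2 j, mul_div_cancel₀ _ (RatFunc.algebraMap_ne_zero hG.1.ne_zero)]

variable {G : Fin m → RatFunc ℝ} {S : StateSpace m n} {D : ℝ[X]} {Nm : Fin m → ℝ[X]}
  {Up : Matrix (Fin N × Fin m) (Fin T) ℝ} {Uf : Matrix (Fin m) (Fin T) ℝ}
  {Yp : Matrix (Fin N) (Fin T) ℝ} {Yf : Matrix (Fin 1) (Fin T) ℝ}

theorem natDegree_mul_fraction_le (hG : IsFraction G n D Nm) (hN : n ≤ N) {R : ℝ[X]}
    (hR : R.natDegree ≤ N - n) :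
    (R * D).natDegree ≤ N ∧ ∀ j, (R * Nm j).natDegree ≤ N := by
  have h1 := hG.2.1
  refine ⟨natDegree_mul_le.trans (by omega), fun j => natDegree_mul_le.trans ?_⟩
  have h2 := hG.2.2.1 j
  omega

/-- The difference equation of the multiple by `R`, solved for the term in the current output, the
only one that `H` does not contain. -/
theorem multipleRow_vecMul (hS : S.IsMinimalRealization G) (hG : IsFraction G n D Nm)
    (hN : n ≤ N) (hdata : IsData S Up Uf Yp Yf) {R : ℝ[X]} (hR : R.natDegree ≤ N - n) :
    multipleRow N D Nm R ᵥ* dataMatrix Up Uf Yp = (R * D).coeff N • Yf 0 := by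
  ext c
  obtain ⟨hd1, hd2⟩ := natDegree_mul_fraction_le hG hN hR
  have hC : S.C ᵥ* aeval S.A (R * D) = 0 := by
    rw [mul_comm, map_mul, ← Matrix.vecMul_vecMul, hS.vecMul_aeval_eq_zero hG.mul_eq,
      Matrix.zero_vecMul]
  have h := (hdata c).sum_eq (Nat.lt_succ_of_le hd1) (fun j => Nat.lt_succ_of_le (hd2 j)) hC
    fun j => by rw [hS.1, map_mul, map_mul, mul_assoc, hG.mul_eq]
  simp only [Fin.sum_univ_castSucc, Fin.snoc_castSucc, Fin.snoc_last, Fin.val_castSucc,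
    Fin.val_last] at h
  rw [Matrix.vecMul, dotProduct, sum_regIndex]
  simp only [multipleRow, dataMatrix, LinearMap.coe_mk, AddHom.coe_mk, Sum.elim_inl, Sum.elim_inr,
    Matrix.fromRows_apply_inl, Matrix.fromRows_apply_inr, neg_mul, Finset.sum_neg_distrib,
    Pi.smul_apply, smul_eq_mul]
  rw [← h]
  ring

theorem coeff_mul_eq_zero (hG : IsFraction G n D Nm) (hN : n ≤ N) {R : ℝ[X]}
    (hR : R.degree < (N - n : ℕ)) {k : ℕ} (hk : N ≤ k) : (R * D).coeff k = 0 := by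
  refine coeff_eq_zero_of_degree_lt ?_
  rw [degree_mul, degree_eq_natDegree hG.1.ne_zero, hG.2.1]
  refine (WithBot.add_lt_add_right (by simp) hR).trans_le ?_
  norm_cast
  omega

/-- Multiples with `deg R < N - n` have no term in the current output, so they lie in the left
kernel. They form a space of dimension `N - n`, and the rank hypothesis gives the kernel exactly
this dimension: `m (N + 1) + N - (m (N + 1) + n)`. -/
theorem vecMul_eq_zero_iff_multipleRow (hS : S.IsMinimalRealization G)
    (hG : IsFraction G n D Nm) (hN : n ≤ N) (hdata : IsData S Up Uf Yp Yf)
    (hrank : (dataMatrix Up Uf Yp).rank = m * (N + 1) + n) (g : RegIndex m N → ℝ) :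
    g ᵥ* dataMatrix Up Uf Yp = 0 ↔ ∃ R : ℝ[X], R.degree < (N - n : ℕ) ∧
      multipleRow N D Nm R = g := by
  set H := dataMatrix Up Uf Yp with hH
  have hker : ∀ R : ℝ[X], R.degree < (N - n : ℕ) → multipleRow N D Nm R ᵥ* H = 0 := by
    intro R hR
    rw [multipleRow_vecMul hS hG hN hdata (natDegree_le_of_degree_le hR.le),
      coeff_mul_eq_zero hG hN hR le_rfl, zero_smul]
  refine ⟨fun hg => ?_, fun ⟨R, hR, h⟩ => h ▸ hker R hR⟩
  let Φ : degreeLT ℝ (N - n) →ₗ[ℝ] (RegIndex m N → ℝ) :=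
    (multipleRow N D Nm).comp (degreeLT ℝ (N - n)).subtype
  have hinj : Function.Injective Φ := by
    rw [← LinearMap.ker_eq_bot, LinearMap.ker_eq_bot']
    rintro ⟨R, hR⟩ h0
    rw [mem_degreeLT] at hR
    -- The row records only coefficients below `N`; the others vanish by degree.
    have h1 : R * D = 0 := by
      ext k
      rcases lt_or_ge k N with hk | hk
      · have := congrFun h0 (Sum.inr ⟨k, hk⟩)
        exact neg_eq_zero.mp this
      · exact coeff_mul_eq_zero hG hN hR hk
    exact Subtype.ext ((mul_eq_zero.mp h1).resolve_right hG.1.ne_zero)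
  have hle : Φ.range ≤ H.vecMulLinear.ker := by
    rintro _ ⟨⟨R, hR⟩, rfl⟩
    exact hker R (mem_degreeLT.mp hR)
  have hfin : Module.finrank ℝ Φ.range = Module.finrank ℝ H.vecMulLinear.ker := by
    rw [LinearMap.finrank_range_of_inj hinj, (degreeLTEquiv ℝ (N - n)).finrank_eq,
      Module.finrank_fin_fun]
    have h1 := H.vecMulLinear.finrank_range_add_finrank_ker
    have h2 : Module.finrank ℝ H.vecMulLinear.range = m * (N + 1) + n := by
      rw [← hrank, ← Matrix.rank_transpose, Matrix.rank, Matrix.mulVecLin_transpose]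
    rw [h2, Module.finrank_fintype_fun_eq_card, Fintype.card_sum, Fintype.card_sum,
      Fintype.card_prod, Fintype.card_fin, Fintype.card_fin, mul_comm N m, mul_add, mul_one] at h1
    omega
  have hmem : g ∈ Φ.range := by
    rw [Submodule.eq_of_le_of_finrank_eq hle hfin]
    exact hg
  obtain ⟨⟨R, hR⟩, h⟩ := hmem
  exact ⟨R, mem_degreeLT.mp hR, h⟩

/-- The minimum-norm predictor is a monic multiple of the transfer function. -/
theorem exists_multipleRow_eq (hS : S.IsMinimalRealization G)
    (hG : IsFraction G n D Nm) (hN : n ≤ N) (hdata : IsData S Up Uf Yp Yf)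
    (hrank : (dataMatrix Up Uf Yp).rank = m * (N + 1) + n) :
    ∃ P : ℝ[X], P.Monic ∧ P.natDegree = N - n ∧
      (Yf * pinv (dataMatrix Up Uf Yp)) 0 = multipleRow N D Nm P := by
  set H := dataMatrix Up Uf Yp with hH
  -- One exact predictor, with all its latent poles at the origin, shows that `Yf` lies in the row
  -- space of `H`. Hence `h⋆` also reproduces `Yf`, and the two differ by a kernel vector.
  have h0 : multipleRow N D Nm (X ^ (N - n)) ᵥ* H = Yf 0 := by
    rw [multipleRow_vecMul hS hG hN hdata (natDegree_X_pow _).le]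
    have h1 : (X ^ (N - n) * D).Monic := (monic_X_pow _).mul hG.1
    have h2 : (X ^ (N - n) * D).natDegree = N := by
      rw [(monic_X_pow _).natDegree_mul hG.1, natDegree_X_pow, hG.2.1]
      omega
    have h3 := h1.coeff_natDegree
    rw [h2] at h3
    rw [h3, one_smul]
  have h1 : (Yf * pinv H) 0 = (multipleRow N D Nm (X ^ (N - n)) ᵥ* H) ᵥ* pinv H := by
    rw [h0]
    rfl
  obtain ⟨R, hR, hg⟩ := (vecMul_eq_zero_iff_multipleRow hS hG hN hdata hrank
    ((Yf * pinv H) 0 - multipleRow N D Nm (X ^ (N - n)))).mp (by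
      rw [← hH, Matrix.sub_vecMul, h1, Matrix.vecMul_vecMul, Matrix.vecMul_vecMul,
        ← Matrix.mul_assoc, (pinv_spec H).1, sub_self])
  refine ⟨X ^ (N - n) + R, monic_X_pow_add hR, ?_, ?_⟩
  · rw [natDegree_add_eq_left_of_degree_lt (by rwa [degree_X_pow]), natDegree_X_pow]
  · rw [map_add, hg, add_sub_cancel]

/-- Since `H⁺ = H⁺ (H H⁺)` with `H H⁺` symmetric, the rows of `Y H⁺` lie in the column space of `H`.
-/
theorem mul_pinv_dotProduct_eq_zero {ι κ ν : Type*} [Fintype ι] [Fintype κ] [DecidableEq ι]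
    [DecidableEq κ] (H : Matrix ι κ ℝ) (Y : Matrix ν κ ℝ) (a : ν) {g : ι → ℝ}
    (hg : g ᵥ* H = 0) : (Y * pinv H) a ⬝ᵥ g = 0 := by
  have h1 : Y * pinv H = Y * pinv H * (H * pinv H) := by
    rw [Matrix.mul_assoc Y, ← Matrix.mul_assoc (pinv H), (pinv_spec H).2.1]
  have h2 : (Y * pinv H) a = (Y * pinv H) a ᵥ* (H * pinv H) := congrFun h1 a
  rw [h2, ← Matrix.dotProduct_mulVec, ← (pinv_spec H).2.2.1, Matrix.mulVec_transpose,
    ← Matrix.vecMul_vecMul, hg, Matrix.zero_vecMul, dotProduct_zero]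

/-- The latent poles of the minimum-norm predictor are stable. -/
theorem isSchur_of_multipleRow_eq (hS : S.IsMinimalRealization G)
    (hG : IsFraction G n D Nm) (hN : n ≤ N) (hdata : IsData S Up Uf Yp Yf)
    {P : ℝ[X]} (hP : P.Monic) (hPd : P.natDegree = N - n)
    (h : (Yf * pinv (dataMatrix Up Uf Yp)) 0 = multipleRow N D Nm P) : IsSchur P := by
  refine isSchur_of_orthogonal (M := fun o : Option (Fin m) => o.elim D Nm) (i₀ := none)
    (n := n) hP hPd ?_ hG.1 hG.2.1 fun k hk => ?_
  · rintro (_ | j)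
    · exact hG.2.1.le
    · exact hG.2.2.1 j
  · have hdeg : (X ^ k : ℝ[X]).degree < (N - n : ℕ) := by
      rw [degree_X_pow]
      exact_mod_cast hk
    -- Predictor rows omit the coefficient of the denominator at `z ^ N`. It vanishes for `X ^ k *
    -- D`, so the dot product of rows is the full weighted inner product.
    have h0 := coeff_mul_eq_zero hG hN hdeg le_rfl
    have hker : multipleRow N D Nm (X ^ k) ᵥ* dataMatrix Up Uf Yp = 0 := by
      rw [multipleRow_vecMul hS hG hN hdata (natDegree_le_of_degree_le hdeg.le), h0, zero_smul]
    have horth := mul_pinv_dotProduct_eq_zero _ Yf 0 hker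
    rw [h, dotProduct, sum_regIndex] at horth
    simp only [multipleRow, LinearMap.coe_mk, AddHom.coe_mk, Sum.elim_inl, Sum.elim_inr,
      neg_mul_neg] at horth
    rw [Fintype.sum_option]
    have hNn : N - n + n = N := Nat.sub_add_cancel hN
    rw [hNn]
    simp only [Option.elim, Fin.sum_univ_castSucc, Fin.val_castSucc, Fin.val_last, h0, mul_zero,
      add_zero]
    rw [← horth, add_comm]

/-! ### The predictor polynomials -/

theorem monic_polePoly (h : Matrix (Fin 1) (RegIndex m N) ℝ) : (polePoly h).Monic :=
  monic_X_pow_sub (degree_sum_fin_lt _)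

theorem natDegree_polePoly (h : Matrix (Fin 1) (RegIndex m N) ℝ) : (polePoly h).natDegree = N := by
  refine natDegree_eq_of_degree_eq_some ?_
  rw [polePoly, degree_sub_eq_left_of_degree_lt, degree_X_pow]
  rw [degree_X_pow]
  exact degree_sum_fin_lt _

theorem continuous_coeff_polePoly (k : ℕ) :
    Continuous fun h : Matrix (Fin 1) (RegIndex m N) ℝ => (polePoly h).coeff k := by
  simp only [polePoly, coeff_sub, finsetSum_coeff, coeff_C_mul]
  fun_prop

theorem polePoly_eq {h : Matrix (Fin 1) (RegIndex m N) ℝ} {P : ℝ[X]}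
    (hP : (P * D).Monic) (hPd : (P * D).natDegree = N) (hh : h 0 = multipleRow N D Nm P) :
    polePoly h = P * D := by
  rw [hP.as_sum, hPd, polePoly, ← Fin.sum_univ_eq_sum_range
    (fun k => C ((P * D).coeff k) * X ^ k), sub_eq_add_neg, ← Finset.sum_neg_distrib]
  congr 1
  refine Finset.sum_congr rfl fun k _ => ?_
  rw [hh]
  simp [multipleRow]

theorem numPoly_eq {h : Matrix (Fin 1) (RegIndex m N) ℝ} {P : ℝ[X]} {j : Fin m}
    (hPd : (P * Nm j).natDegree ≤ N) (hh : h 0 = multipleRow N D Nm P) :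
    numPoly h j = P * Nm j := by
  rw [(P * Nm j).as_sum_range_C_mul_X_pow' (Nat.lt_succ_of_le hPd), ← Fin.sum_univ_eq_sum_range
    (fun k => C ((P * Nm j).coeff k) * X ^ k), Fin.sum_univ_castSucc, numPoly, hh]
  rfl

/-- With a scalar output the observability matrix gains only one row per step. -/
theorem StateSpace.IsLag.le {l : ℕ} (hl : S.IsLag l) : n ≤ l := by
  have h : (S.obsMatrix l).rank = n := hl.1
  have h2 := (S.obsMatrix l).rank_le_height
  omega

/-! ### Continuity of the predictor poles in the noise. -/

open Filter Topology in
theorem tendsto_matrix_mul {α ι κ ν : Type*} [Fintype ι] [Fintype κ] [Fintype ν]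
    [DecidableEq κ] [DecidableEq ν] {l : Filter α} {f : α → Matrix ι κ ℝ}
    {g : α → Matrix κ ν ℝ} {A : Matrix ι κ ℝ} {B : Matrix κ ν ℝ} (hf : Tendsto f l (𝓝 A))
    (hg : Tendsto g l (𝓝 B)) : Tendsto (fun a => f a * g a) l (𝓝 (A * B)) := by
  have h : Continuous fun Z : Matrix ι κ ℝ × Matrix κ ν ℝ => Z.1 * Z.2 := by fun_prop
  exact (h.tendsto (A, B)).comp (hf.prodMk_nhds hg)

open Filter Topology in
/-- The roots of the predictor computed with the truncated Moore–Penrose inverse depend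
continuously on the noise. -/
theorem eventually_exists_roots_polePoly {ι : Type*} [Fintype ι] (hι : Fintype.card ι = N)
    {H : Matrix (RegIndex m N) (Fin T) ℝ} {τ : ℝ} (hτ0 : 0 < τ) (hτ : τ < sigmaMin H) {r : ι → ℂ}
    (hr : (polePoly (Yf * pinv H)).map (algebraMap ℝ ℂ) = ∏ i, (X - C (r i)))
    {V : ι → Set ℂ} (hV : ∀ i, V i ∈ 𝓝 (r i)) :
    ∃ δ > 0, ∀ (E : Matrix (RegIndex m N) (Fin T) ℝ) (e : Matrix (Fin 1) (Fin T) ℝ),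
      ‖Matrix.fromCols Eᵀ eᵀ‖ < δ → ∃ r' : ι → ℂ,
        (polePoly ((Yf + e) * truncPinv τ (H + E))).map (algebraMap ℝ ℂ) =
          ∏ i, (X - C (r' i)) ∧ ∀ i, r' i ∈ V i := by
  -- The predictor as a function of the stacked noise `[Eᵀ, eᵀ]`, so that a single neighbourhood of
  -- `0` yields `δ`.
  let P : Matrix (Fin T) (RegIndex m N ⊕ Fin 1) ℝ → Matrix (Fin 1) (RegIndex m N) ℝ :=
    fun Z => (Yf + Z.toCols₂ᵀ) * truncPinv τ (H + Z.toCols₁ᵀ)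
  have hP : Tendsto P (𝓝 0) (𝓝 (Yf * pinv H)) := by
    have c1 : Continuous fun Z : Matrix (Fin T) (RegIndex m N ⊕ Fin 1) ℝ => H + Z.toCols₁ᵀ :=
      continuous_const.add (continuous_matrix fun i j => continuous_id.matrix_elem j (Sum.inl i))
    have c2 : Continuous fun Z : Matrix (Fin T) (RegIndex m N ⊕ Fin 1) ℝ => Yf + Z.toCols₂ᵀ :=
      continuous_const.add (continuous_matrix fun i j => continuous_id.matrix_elem j (Sum.inr i))
    have t1 := c1.tendsto 0
    have t2 := c2.tendsto 0
    rw [show H + (0 : Matrix (Fin T) (RegIndex m N ⊕ Fin 1) ℝ).toCols₁ᵀ = H from add_zero H] at t1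
    rw [show Yf + (0 : Matrix (Fin T) (RegIndex m N ⊕ Fin 1) ℝ).toCols₂ᵀ = Yf from
      add_zero Yf] at t2
    have t3 := (tendsto_truncPinv hτ0 hτ).comp t1
    exact tendsto_matrix_mul t2 t3
  have hev := eventually_exists_roots_mem (l := 𝓝 0)
    (P := fun Z => (polePoly (P Z)).map (algebraMap ℝ ℂ))
    (fun Z => (monic_polePoly (P Z)).map _)
    (fun Z => by rw [(monic_polePoly (P Z)).natDegree_map, natDegree_polePoly, hι]) (r := r)
    (fun k => by
      rw [← hr, coeff_map]
      simp only [coeff_map]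
      exact (((continuous_algebraMap ℝ ℂ).comp (continuous_coeff_polePoly k)).tendsto
        (Yf * pinv H)).comp hP) hV
  obtain ⟨δ, hδ, hball⟩ := Metric.eventually_nhds_iff.mp hev
  refine ⟨δ, hδ, fun E e hEe => ?_⟩
  have := hball (y := Matrix.fromCols Eᵀ eᵀ) (by rwa [dist_zero_right])
  simpa [P] using this

end DataMatrix

end DataDriven

end

/-! ### The main theorem. -/

open DataDriven
theorem theorem2 {m n l N T : ℕ}
    -- the system: transfer function matrix `G`, minimal order `n`, lag `l`
    (G : Fin m → RatFunc ℝ) (S : StateSpace m n) (hS : S.IsMinimalRealization G)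
    (hl : S.IsLag l) (hN : l ≤ N)
    (Dz : ℝ[X]) (Nz : Fin m → ℝ[X]) (hG : IsFraction G n Dz Nz)
    -- the noise-free data and the rank condition
    (Up : Matrix (Fin N × Fin m) (Fin T) ℝ) (Uf : Matrix (Fin m) (Fin T) ℝ)
    (Yp : Matrix (Fin N) (Fin T) ℝ) (Yf : Matrix (Fin 1) (Fin T) ℝ)
    (hdata : IsData S Up Uf Yp Yf)
    (hrank : (dataMatrix Up Uf Yp).rank = m * (N + 1) + n)
    -- the tolerance
    (τ : ℝ) (hτ0 : 0 < τ) (hτ : τ < sigmaMin (dataMatrix Up Uf Yp)) :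
    -- the latent poles are the roots of `Cstar`, and are stable
    ∃ Cstar : ℝ[X], Cstar.Monic ∧ Cstar.natDegree = N - n ∧
      polePoly (Yf * pinv (dataMatrix Up Uf Yp)) = Cstar * Dz ∧
      (∀ j, numPoly (Yf * pinv (dataMatrix Up Uf Yp)) j = Cstar * Nz j) ∧
      IsSchur Cstar ∧
      -- the roots, listed with multiplicity
      ∀ (p : Fin n → ℂ) (q : Fin (N - n) → ℂ),
        Dz.map (algebraMap ℝ ℂ) = ∏ k, (Polynomial.X - Polynomial.C (p k)) →
        Cstar.map (algebraMap ℝ ℂ) = ∏ j, (Polynomial.X - Polynomial.C (q j)) →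
        ∀ ε > 0, ∃ δ > 0, ∀ (E : Matrix (RegIndex m N) (Fin T) ℝ) (e : Matrix (Fin 1) (Fin T) ℝ),
          ‖Matrix.fromCols Eᵀ eᵀ‖ < δ →
          ∃ (p' : Fin n → ℂ) (q' : Fin (N - n) → ℂ),
            (polePoly ((Yf + e) * truncPinv τ (dataMatrix Up Uf Yp + E))).map (algebraMap ℝ ℂ) =
              (∏ k, (Polynomial.X - Polynomial.C (p' k))) *
                ∏ j, (Polynomial.X - Polynomial.C (q' j)) ∧
            (∀ k, ‖p' k - p k‖ < ε) ∧ (∀ j, ‖q' j - q j‖ < ε) ∧ ∀ j, ‖q' j‖ < 1 := by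

  have hnN : n ≤ N := hl.le.trans hN
  obtain ⟨P, hPm, hPd, hP⟩ := exists_multipleRow_eq hS hG hnN hdata hrank
  obtain ⟨-, hdeg⟩ := natDegree_mul_fraction_le hG hnN hPd.le
  have hpole : polePoly (Yf * pinv (dataMatrix Up Uf Yp)) = P * Dz := by
    refine polePoly_eq (hPm.mul hG.1) ?_ hP
    rw [hPm.natDegree_mul hG.1, hPd, hG.2.1]
    omega
  have hSchur : IsSchur P := isSchur_of_multipleRow_eq hS hG hnN hdata hPm hPd hP
  refine ⟨P, hPm, hPd, hpole, fun j => numPoly_eq (hdeg j) hP, hSchur, ?_⟩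
  intro p q hp hq ε hε
  have hq1 : ∀ j, ‖q j‖ < 1 := by
    intro j
    refine hSchur _ ?_
    rw [← Polynomial.eval_map_algebraMap, hq, Polynomial.eval_prod]
    exact Finset.prod_eq_zero (Finset.mem_univ j) (by simp)
  obtain ⟨δ, hδ, h⟩ := eventually_exists_roots_polePoly (ι := Fin n ⊕ Fin (N - n)) (Yf := Yf)
    (by simp [hnN]) hτ0 hτ (r := Sum.elim p q)
    (by rw [hpole, Polynomial.map_mul, hp, hq, mul_comm, Fintype.prod_sum_type]; rfl)
    -- Stability of the perturbed latent poles is built into their neighbourhoods, which is possible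
    -- because each `q j` lies in the open unit disc.
    (V := Sum.elim (fun k => Metric.ball (p k) ε) fun j => Metric.ball (q j) ε ∩ Metric.ball 0 1)
    (by
      rintro (k | j)
      · exact Metric.ball_mem_nhds _ hε
      · exact Filter.inter_mem (Metric.ball_mem_nhds _ hε)
          (Metric.isOpen_ball.mem_nhds (mem_ball_zero_iff.mpr (hq1 j))))
  refine ⟨δ, hδ, fun E e hEe => ?_⟩
  obtain ⟨r', hr', hmem⟩ := h E e hEe
  refine ⟨fun k => r' (Sum.inl k), fun j => r' (Sum.inr j), ?_, fun k => ?_, fun j => ?_,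
    fun j => ?_⟩
  · rw [hr', Fintype.prod_sum_type]
  · exact mem_ball_iff_norm.mp (hmem (Sum.inl k))
  · exact mem_ball_iff_norm.mp (hmem (Sum.inr j)).1
  · exact mem_ball_zero_iff.mp (hmem (Sum.inr j)).2
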